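/- Let $n\ge 2$ and let $D\subset\mathbb{C}^n$ be a bounded domain (nonempty connected open set) that is smoothly bounded: there are an open neighborhood $V$ of the boundary $bD$ and a real function $\rho\in C^\infty(V)$ with $d\rho\neq 0$ on $bD$ and $D\cap V=\{x\in V:\rho(x)<0\}$. Let $X=bD$, equipped with the induced CR structure $T_{0,1}X=T_{0,1}\mathbb{C}^n\cap(\mathbb{C}\otimes TX)$, and let $\mu$ be any smooth positive measure on $X$, i.e. a Borel measure with a smooth positive density with respect to Lebesgue measure in local coordinates. For a smooth complex vector field $Z$ on $X$ let $Z^\dagger$ be its formal adjoint with respect to $\mu$, defined by $\int_X g\,Z^\dagger\varphi\,d\mu=\int_X\varphi\,Zg\,d\mu$ for all $g,\varphi\in C^\infty(X)$. Let $\mathrm{CR}^2(X,\mu)$ be the closed subspace of those $f\in L^2(X,\mu)$ with $\int_X f\,Z^\dagger\varphi\,d\mu=0$ for all smooth sections $Z$ of $T_{0,1}X$ and all $\varphi\in C^\infty(X)$, and let $\mathcal{S}_{X,\mu}$ (the Szegő projection) be the orthogonal projection of $L^2(X,\mu)$ onto $\mathrm{CR}^2(X,\mu)$. Then $\mathcal{S}_{X,\mu}$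 is unbounded on $L^1$: there is no finite constant $C$ such that $$\|\mathcal{S}_{X,\mu}f\|_{L^1(X,\mu)}\le C\,\|f\|_{L^1(X,\mu)}\qquad\text{for all } f\in L^2(X,\mu)\cap L^1(X,\mu).$$ -/

import Mathlib

open MeasureTheory
open scoped ContDiff ENNReal NNReal Topology

noncomputable section

namespace Szego

/-- A domain in `ℂⁿ` (a nonempty connected open set) that is smoothly bounded: some real
function `ρ`, smooth on an open neighbourhood `V` of the boundary, satisfies `dρ ≠ 0` on the
boundary and `D ∩ V = {ρ < 0}`. -/
structure IsSmoothlyBoundedDomain {n : ℕ} (D : Set (EuclideanSpace ℂ (Fin n))) : Prop where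
  isOpen : IsOpen D
  isConnected : IsConnected D
  exists_defining : ∃ (V : Set (EuclideanSpace ℂ (Fin n))) (ρ : EuclideanSpace ℂ (Fin n) → ℝ),
    IsOpen V ∧ frontier D ⊆ V ∧ ContDiffOn ℝ ∞ ρ V ∧
    (∀ x ∈ frontier D, fderiv ℝ ρ x ≠ 0) ∧ D ∩ V = {x ∈ V | ρ x < 0}

/-- A smooth chart of the real hypersurface `X ⊆ ℂⁿ`: a homeomorphism `e` from an open subset of
`X` onto an open subset of `ℝ^(2n-1)` whose inverse, as a map into `ℂⁿ`, is a smooth immersion. -/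
structure IsSmoothChart {n : ℕ} (X : Set (EuclideanSpace ℂ (Fin n)))
    (e : OpenPartialHomeomorph X (EuclideanSpace ℝ (Fin (2 * n - 1)))) : Prop where
  contDiffOn : ContDiffOn ℝ ∞ (fun y => (e.symm y : EuclideanSpace ℂ (Fin n))) e.target
  injective : ∀ y ∈ e.target,
    Function.Injective (fderiv ℝ (fun y => (e.symm y : EuclideanSpace ℂ (Fin n))) y)

/-- A smooth positive measure on the hypersurface `X`: around every point there are local
coordinates in which `μ` has a smooth positive density with respect to Lebesgue measure. -/
class IsSmoothPositiveMeasure {n : ℕ} (X : Set (EuclideanSpace ℂ (Fin n)))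
    (μ : Measure X) : Prop where
  exists_density : ∀ x : X,
    ∃ (e : OpenPartialHomeomorph X (EuclideanSpace ℝ (Fin (2 * n - 1))))
      (w : EuclideanSpace ℝ (Fin (2 * n - 1)) → ℝ),
      IsSmoothChart X e ∧ x ∈ e.source ∧ ContDiffOn ℝ ∞ w e.target ∧ (∀ y ∈ e.target, 0 < w y) ∧
      (μ.restrict e.source).map e =
        (volume.restrict e.target).withDensity (fun y => ENNReal.ofReal (w y))

instance {n : ℕ} (X : Set (EuclideanSpace ℂ (Fin n))) (μ : Measure X)
    [h : IsSmoothPositiveMeasure X μ] : IsLocallyFiniteMeasure μ where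
  finiteAtNhds x := by
    obtain ⟨e, w, -, hx, hw, -, hμ⟩ := h.exists_density x
    obtain ⟨K, hK, hKt, hKc⟩ := local_compact_nhds (e.open_target.mem_nhds (e.map_source hx))
    refine ⟨e.source ∩ e ⁻¹' K, Filter.inter_mem (e.open_source.mem_nhds hx)
      ((e.continuousAt hx).preimage_mem_nhds hK), ?_⟩
    have he : AEMeasurable e (μ.restrict e.source) :=
      e.continuousOn.aemeasurable e.open_source.measurableSet
    have h1 : μ (e.source ∩ e ⁻¹' K) = (μ.restrict e.source).map e K := by
      rw [Measure.map_apply_of_aemeasurable he hKc.measurableSet,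
        Measure.restrict_apply' e.open_source.measurableSet, Set.inter_comm]
    rw [h1, hμ, withDensity_apply _ hKc.measurableSet,
      Measure.restrict_restrict hKc.measurableSet, Set.inter_eq_self_of_subset_left hKt]
    exact ((hw.continuousOn.mono hKt).integrableOn_compact hKc).lintegral_lt_top

/-- The tangent vectors of `X` at `x`: velocities of smooth curves in `X` through `x`. -/
def tangentVectors {n : ℕ} (X : Set (EuclideanSpace ℂ (Fin n))) (x : EuclideanSpace ℂ (Fin n)) :
    Set (EuclideanSpace ℂ (Fin n)) :=
  {v | ∃ γ : ℝ → EuclideanSpace ℂ (Fin n), γ 0 = x ∧ (∀ᶠ t in 𝓝 (0 : ℝ), γ t ∈ X) ∧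
    ContDiffAt ℝ ∞ γ 0 ∧ deriv γ 0 = v}

/-- A smooth complex vector field `re + i im` along a subset of `ℂⁿ`, that is, a section of the
complexification of the real tangent bundle of `ℂⁿ`; `re` and `im` are real vector fields. -/
structure ComplexVectorField (n : ℕ) where
  re : EuclideanSpace ℂ (Fin n) → EuclideanSpace ℂ (Fin n)
  im : EuclideanSpace ℂ (Fin n) → EuclideanSpace ℂ (Fin n)
  contDiff_re : ContDiff ℝ ∞ re
  contDiff_im : ContDiff ℝ ∞ im

/-- The action of a complex vector field on a function: `Z g = dg(re) + i dg(im)`. -/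
def ComplexVectorField.apply {n : ℕ} (Z : ComplexVectorField n)
    (g : EuclideanSpace ℂ (Fin n) → ℂ) (x : EuclideanSpace ℂ (Fin n)) : ℂ :=
  fderiv ℝ g x (Z.re x) + Complex.I * fderiv ℝ g x (Z.im x)

/-- `Z` restricts to a section over `X` of `T_{0,1}X = T_{0,1}ℂⁿ ∩ ℂTX`. A complex tangent vector
`a + i b` of `ℂⁿ` is of type `(0,1)`, i.e. a combination of the
`∂/∂z̄_j = (∂/∂x_j + i ∂/∂y_j) / 2`, exactly when `b = J a`, where `J` is multiplication by `i`;
it lies in `ℂTX` when `a` and `b` are tangent to `X`. -/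
def ComplexVectorField.IsSectionT01 {n : ℕ} (X : Set (EuclideanSpace ℂ (Fin n)))
    (Z : ComplexVectorField n) : Prop :=
  ∀ x ∈ X, Z.re x ∈ tangentVectors X x ∧ Z.im x ∈ tangentVectors X x ∧
    Z.im x = Complex.I • Z.re x

/-- The restriction of `φ` to `X` is a test function. Smooth functions on the closed
hypersurface `X` are represented by smooth functions on `ℂⁿ`. -/
def IsTestFunction {n : ℕ} (X : Set (EuclideanSpace ℂ (Fin n)))
    (φ : EuclideanSpace ℂ (Fin n) → ℂ) : Prop :=
  ContDiff ℝ ∞ φ ∧ HasCompactSupport (fun x : X => φ x)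

/-- `ψ = Z† φ` on `X`, where `Z†` is the formal adjoint (transpose) of `Z` with respect to `μ`:
`∫ g Z†φ dμ = ∫ φ Zg dμ` for every smooth `g`. -/
def IsFormalAdjoint {n : ℕ} {X : Set (EuclideanSpace ℂ (Fin n))} (μ : Measure X)
    (Z : ComplexVectorField n) (φ ψ : EuclideanSpace ℂ (Fin n) → ℂ) : Prop :=
  ∀ g : EuclideanSpace ℂ (Fin n) → ℂ, ContDiff ℝ ∞ g →
    ∫ x : X, g x * ψ x ∂μ = ∫ x : X, φ x * Z.apply g x ∂μ

/-- `f` is annihilated by all sections of `T_{0,1}X` in the sense of distributions: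
`∫ f Z†φ dμ = 0` for every smooth section `Z` of `T_{0,1}X` and every test function `φ`. -/
def IsCR {n : ℕ} {X : Set (EuclideanSpace ℂ (Fin n))} (μ : Measure X) (f : X → ℂ) : Prop :=
  ∀ Z : ComplexVectorField n, Z.IsSectionT01 X →
    ∀ φ ψ : EuclideanSpace ℂ (Fin n) → ℂ, IsTestFunction X φ → IsTestFunction X ψ →
      IsFormalAdjoint μ Z φ ψ → ∫ x : X, f x * ψ x ∂μ = 0

lemma IsTestFunction.memLp {n : ℕ} {X : Set (EuclideanSpace ℂ (Fin n))} (μ : Measure X)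
    [IsLocallyFiniteMeasure μ] {ψ : EuclideanSpace ℂ (Fin n) → ℂ} (h : IsTestFunction X ψ) :
    MemLp (fun x : X => ψ x) 2 μ :=
  (h.1.continuous.comp continuous_subtype_val).memLp_of_hasCompactSupport h.2

lemma integrable_mul_test {n : ℕ} {X : Set (EuclideanSpace ℂ (Fin n))} (μ : Measure X)
    [IsLocallyFiniteMeasure μ] {ψ : EuclideanSpace ℂ (Fin n) → ℂ} (h : IsTestFunction X ψ)
    (f : Lp ℂ 2 μ) : Integrable (fun x : X => f x * ψ x) μ :=
  (Lp.memLp f).integrable_mul (h.memLp μ)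

/-- The space of square-integrable CR functions on `X`. -/
def CR2 {n : ℕ} {X : Set (EuclideanSpace ℂ (Fin n))} (μ : Measure X)
    [IsLocallyFiniteMeasure μ] : Submodule ℂ (Lp ℂ 2 μ) where
  carrier := {f | IsCR μ f}
  zero_mem' := by
    intro Z _ φ ψ _ _ _
    have : (fun x : X => (0 : Lp ℂ 2 μ) x * ψ x) =ᵐ[μ] fun _ => 0 := by
      filter_upwards [Lp.coeFn_zero ℂ 2 μ] with x hx
      rw [hx, Pi.zero_apply, zero_mul]
    rw [integral_congr_ae this, integral_zero]
  add_mem' := by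
    intro f g hf hg Z hZ φ ψ hφ hψ h
    have : (fun x : X => (f + g) x * ψ x) =ᵐ[μ] fun x => f x * ψ x + g x * ψ x := by
      filter_upwards [Lp.coeFn_add f g] with x hx
      rw [hx, Pi.add_apply, add_mul]
    rw [integral_congr_ae this, integral_add (integrable_mul_test μ hψ f)
      (integrable_mul_test μ hψ g), hf Z hZ φ ψ hφ hψ h, hg Z hZ φ ψ hφ hψ h, add_zero]
  smul_mem' := by
    intro c f hf Z hZ φ ψ hφ hψ h
    have : (fun x : X => (c • f) x * ψ x) =ᵐ[μ] fun x => c * (f x * ψ x) := by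
      filter_upwards [Lp.coeFn_smul c f] with x hx
      simp [hx, mul_assoc]
    rw [integral_congr_ae this, integral_const_mul, hf Z hZ φ ψ hφ hψ h, mul_zero]

lemma isClosed_CR2 {n : ℕ} {X : Set (EuclideanSpace ℂ (Fin n))} (μ : Measure X)
    [IsLocallyFiniteMeasure μ] : IsClosed (CR2 μ : Set (Lp ℂ 2 μ)) := by
  have key : ∀ ψ : EuclideanSpace ℂ (Fin n) → ℂ, IsTestFunction X ψ →
      IsClosed {f : Lp ℂ 2 μ | ∫ x : X, f x * ψ x ∂μ = 0} := by
    intro ψ hψ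
    have hs : {f : Lp ℂ 2 μ | ∫ x : X, f x * ψ x ∂μ = 0} =
        {f : Lp ℂ 2 μ | inner ℂ ((hψ.memLp μ).star.toLp) f = 0} := by
      ext f
      have : (fun x : X => f x * ψ x) =ᵐ[μ]
          fun x => inner ℂ (((hψ.memLp μ).star.toLp : Lp ℂ 2 μ) x) (f x) := by
        filter_upwards [(hψ.memLp μ).star.coeFn_toLp] with x hx
        simp [hx]
      simp only [Set.mem_ofPred_eq, L2.inner_def, integral_congr_ae this]
    rw [hs]
    exact isClosed_eq (continuous_const.inner continuous_id) continuous_const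
  have : (CR2 μ : Set (Lp ℂ 2 μ)) = ⋂ (Z : ComplexVectorField n) (_ : Z.IsSectionT01 X)
      (φ : EuclideanSpace ℂ (Fin n) → ℂ) (ψ : EuclideanSpace ℂ (Fin n) → ℂ)
      (_ : IsTestFunction X φ) (_ : IsTestFunction X ψ) (_ : IsFormalAdjoint μ Z φ ψ),
      {f : Lp ℂ 2 μ | ∫ x : X, f x * ψ x ∂μ = 0} := by
    ext f
    simp only [Set.mem_iInter]
    rfl
  rw [this]
  exact isClosed_iInter fun Z => isClosed_iInter fun _ => isClosed_iInter fun φ =>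
    isClosed_iInter fun ψ => isClosed_iInter fun _ => isClosed_iInter fun hψ =>
    isClosed_iInter fun _ => key ψ hψ

instance {n : ℕ} {X : Set (EuclideanSpace ℂ (Fin n))} (μ : Measure X)
    [IsLocallyFiniteMeasure μ] : CompleteSpace (CR2 μ) :=
  (isClosed_CR2 μ).completeSpace_coe

/-- The Szegő projection: the orthogonal projection of `L²(X, μ)` onto the CR functions. -/
def szegoProjection {n : ℕ} {X : Set (EuclideanSpace ℂ (Fin n))} (μ : Measure X)
    [IsLocallyFiniteMeasure μ] : Lp ℂ 2 μ →L[ℂ] Lp ℂ 2 μ :=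
  (CR2 μ).starProjection

/-- `‖T f‖_{L¹} ≤ C ‖f‖_{L¹}` for all `f ∈ L² ∩ L¹`, with a finite constant `C`. -/
def IsBoundedOnL1 {α : Type*} [MeasurableSpace α] {μ : Measure α}
    (T : Lp ℂ 2 μ →L[ℂ] Lp ℂ 2 μ) : Prop :=
  ∃ C : ℝ≥0, ∀ f : Lp ℂ 2 μ, MemLp f 1 μ → eLpNorm (T f) 1 μ ≤ C * eLpNorm f 1 μ

end Szego

end

/-!
Let `p` be a point of `X` farthest from some `c ∉ X`. It is a peak point: the holomorphic function
`h(x) = (1 + ⟪p - c, x - c⟫ / ‖p - c‖²) / 2` satisfies `h p = 1` and `‖h‖ < 1` on `X` minus `p`.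
For the bilinear pairing `∫ f g dμ`, the transpose of the Szegő projection fixes `star (h ^ N)`,
because `h ^ N` is CR, and kills every `Z†φ` with `Z` a section of `T_{0,1}X`. Near `p` there are
such `ψ = Z†φ` with `ψ p = 1`, with arbitrarily small support, and yet uniformly bounded, because
`φ` need only be small of first order at `p`. Hence the transpose maps `star (h ^ N) - ψ`, which
vanishes at `p` and is concentrated near `p` for large `N`, to `star (h ^ N)`, whose value at `p`
is `1`. A sum of `J` such humps, each concentrated where the previous ones are small, stays bounded
while its image has value `J` at `p`. So the transpose is unbounded for the supremum norm, and the
projection is unbounded on `L¹`.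
-/

namespace Szego

section Calculus

variable {E F G : Type*} [NormedAddCommGroup E] [NormedSpace ℝ E]
  [NormedAddCommGroup F] [NormedSpace ℝ F] [NormedAddCommGroup G] [NormedSpace ℝ G]

lemma contDiff_of_tsupport {k : ℕ∞ω} {f : E → F} (hf : ∀ x ∈ tsupport f, ContDiffAt ℝ k f x) :
    ContDiff ℝ k f :=
  contMDiff_iff_contDiff.1 (contMDiff_of_tsupport fun x hx => (hf x hx).contMDiffAt)

lemma exists_contDiff_eventuallyEq [FiniteDimensional ℝ E] {U : Set E} {p : E} {f : E → F}
    (hU : IsOpen U) (hp : p ∈ U) (hf : ContDiffOn ℝ ∞ f U) :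
    ∃ g : E → F, ContDiff ℝ ∞ g ∧ g =ᶠ[𝓝 p] f ∧ tsupport g ⊆ U := by
  obtain ⟨r, hr, hrU⟩ := Metric.nhds_basis_closedBall.mem_iff.1 (hU.mem_nhds hp)
  let χ : ContDiffBump p := ⟨r / 2, r, half_pos hr, half_lt_self hr⟩
  have hχ : tsupport (fun x => χ x • f x) ⊆ U :=
    (tsupport_smul_subset_left _ _).trans (χ.tsupport_eq.trans_subset hrU)
  refine ⟨fun x => χ x • f x, contDiff_of_tsupport fun x hx => ?_, ?_, hχ⟩
  · exact χ.contDiffAt.smul (hf.contDiffAt (hU.mem_nhds (hχ hx)))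
  · filter_upwards [χ.eventuallyEq_one] with x hx
    rw [hx, Pi.one_apply, one_smul]

/-- The divergence of a vector field, as the trace of its derivative. -/
noncomputable def divergence (v : E → E) (y : E) : ℝ :=
  LinearMap.trace ℝ E (fderiv ℝ v y)

lemma divergence_eq_sum {ι : Type*} [Fintype ι] (b : Module.Basis ι ℝ E) (v : E → E) (y : E) :
    divergence v y = ∑ i, b.repr (fderiv ℝ v y (b i)) i := by
  classical
  simp only [divergence, LinearMap.trace_eq_matrix_trace ℝ b, Matrix.trace, Matrix.diag,
    LinearMap.toMatrix_apply, ContinuousLinearMap.coe_coe]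

lemma contDiff_divergence [FiniteDimensional ℝ E] {k m : ℕ∞ω} {v : E → E} (hv : ContDiff ℝ m v)
    (hkm : k + 1 ≤ m) : ContDiff ℝ k (divergence v) := by
  let tr : (E →L[ℝ] E) →L[ℝ] ℝ := LinearMap.toContinuousLinearMap
    (LinearMap.trace ℝ E ∘ₗ ContinuousLinearMap.coeLM ℝ)
  exact tr.contDiff.comp (hv.fderiv_right hkm)

lemma divergence_eq_zero_of_notMem_tsupport {v : E → E} {y : E} (hy : y ∉ tsupport v) :
    divergence v y = 0 := by
  rw [divergence, image_eq_zero_of_notMem_tsupport fun h => hy (tsupport_fderiv_subset ℝ h),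
    ContinuousLinearMap.toLinearMap_zero, map_zero]

lemma integrable_smul_of_hasCompactSupport {Y : Type*} [TopologicalSpace Y] [MeasurableSpace Y]
    [OpensMeasurableSpace Y] (μ : Measure Y) [IsFiniteMeasureOnCompacts μ] {c : Y → ℝ} {f : Y → G}
    (hc : Continuous c) (hcs : HasCompactSupport c) (hf : ∀ x ∈ tsupport c, ContinuousAt f x) :
    Integrable (fun x => c x • f x) μ := by
  refine Continuous.integrable_of_hasCompactSupport ?_ hcs.smul_right
  exact continuous_of_tsupport fun x hx =>
    hc.continuousAt.smul (hf x (tsupport_smul_subset_left _ _ hx))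

section IntegrationByParts

variable [MeasurableSpace E] [BorelSpace E] (μ : Measure E) {c : E → ℝ} {f : E → G}

lemma integrable_smul_fderiv_apply [IsFiniteMeasureOnCompacts μ] (hc : Continuous c)
    (hcs : HasCompactSupport c) (hf : ∀ y ∈ tsupport c, ContDiffAt ℝ 1 f y) (w : E) :
    Integrable (fun y => c y • fderiv ℝ f y w) μ :=
  integrable_smul_of_hasCompactSupport μ hc hcs fun y hy =>
    ((hf y hy).continuousAt_fderiv one_ne_zero).clm_apply continuousAt_const

lemma integrable_fderiv_apply_smul [IsFiniteMeasureOnCompacts μ] (hc : ContDiff ℝ 1 c)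
    (hcs : HasCompactSupport c) (hf : ∀ y ∈ tsupport c, ContinuousAt f y) (w : E) :
    Integrable (fun y => fderiv ℝ c y w • f y) μ :=
  integrable_smul_of_hasCompactSupport μ
    ((hc.continuous_fderiv one_ne_zero).clm_apply continuous_const)
    ((hcs.fderiv ℝ).comp_left (g := fun L : E →L[ℝ] ℝ => L w) rfl) fun y hy =>
    hf y (tsupport_fderiv_apply_subset ℝ w hy)

variable [FiniteDimensional ℝ E] [μ.IsAddHaarMeasure]

lemma integral_smul_fderiv_apply_eq_neg (hc : ContDiff ℝ 1 c) (hcs : HasCompactSupport c)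
    (hf : ∀ y ∈ tsupport c, ContDiffAt ℝ 1 f y) (w : E) :
    ∫ y, c y • fderiv ℝ f y w ∂μ = -∫ y, fderiv ℝ c y w • f y ∂μ :=
  integral_smul_fderiv_eq_neg_fderiv_smul_of_integrable
    (integrable_fderiv_apply_smul μ hc hcs (fun y hy => (hf y hy).continuousAt) w)
    (integrable_smul_fderiv_apply μ hc.continuous hcs hf w)
    (integrable_smul_of_hasCompactSupport μ hc.continuous hcs fun y hy => (hf y hy).continuousAt)
    (fun y _ => hc.differentiable one_ne_zero y) fun y hy => (hf y hy).differentiableAt one_ne_zero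

theorem integral_fderiv_apply_eq_neg_integral_divergence_smul {v : E → E}
    (hv : ContDiff ℝ 1 v) (hvc : HasCompactSupport v) (hf : ∀ y ∈ tsupport v, ContDiffAt ℝ 1 f y) :
    ∫ y, fderiv ℝ f y (v y) ∂μ = -∫ y, divergence v y • f y ∂μ := by
  let b := Module.finBasis ℝ E
  let c (i) : E →L[ℝ] ℝ := LinearMap.toContinuousLinearMap (b.coord i)
  have hcc (i) : HasCompactSupport (c i ∘ v) := hvc.comp_left (map_zero _)
  have hcv (i) : ContDiff ℝ 1 (c i ∘ v) := (c i).contDiff.comp hv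
  have hfc (i) : ∀ y ∈ tsupport (c i ∘ v), ContDiffAt ℝ 1 f y := fun y hy =>
    hf y (tsupport_comp_subset (map_zero _) v hy)
  have hcoord (y) : fderiv ℝ f y (v y) = ∑ i, (c i ∘ v) y • fderiv ℝ f y (b i) := by
    conv_lhs => rw [← b.sum_repr (v y), map_sum]
    simp only [map_smul, c, Function.comp_apply, LinearMap.coe_toContinuousLinearMap',
      Module.Basis.coord_apply]
  have hdiv (y) : divergence v y • f y = ∑ i, fderiv ℝ (c i ∘ v) y (b i) • f y := by
    rw [divergence_eq_sum b, Finset.sum_smul]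
    refine Finset.sum_congr rfl fun i _ => ?_
    rw [((c i).hasFDerivAt.comp y (hv.differentiable one_ne_zero y).hasFDerivAt).fderiv]
    rfl
  simp only [hcoord, hdiv]
  rw [integral_finsetSum _ fun i _ =>
      integrable_smul_fderiv_apply μ (hcv i).continuous (hcc i) (hfc i) (b i),
    integral_finsetSum _ fun i _ =>
      integrable_fderiv_apply_smul μ (hcv i) (hcc i) (fun y hy => (hfc i y hy).continuousAt) (b i),
    Finset.sum_congr rfl fun i _ =>
      integral_smul_fderiv_apply_eq_neg μ (hcv i) (hcc i) (hfc i) (b i), Finset.sum_neg_distrib]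

end IntegrationByParts

end Calculus

section InverseFunction

variable {E F : Type*} [NormedAddCommGroup E] [NormedSpace ℝ E] [NormedAddCommGroup F]
  [NormedSpace ℝ F] [FiniteDimensional ℝ F] {O : Set F} {y₀ : F}

lemma exists_contDiff_eventually_leftInverse_of_fderiv_eq {g : F → F} (hO : IsOpen O) (hy₀ : y₀ ∈ O)
    (hg : ContDiffOn ℝ ∞ g O) (A : F ≃L[ℝ] F) (hA : fderiv ℝ g y₀ = A) :
    ∃ h : F → F, ContDiff ℝ ∞ h ∧ ∀ᶠ y in 𝓝 y₀, h (g y) = y := by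
  have hgAt : ContDiffAt ℝ ∞ g y₀ := hg.contDiffAt (hO.mem_nhds hy₀)
  have hA' : HasFDerivAt g (A : F →L[ℝ] F) y₀ :=
    hA ▸ (hgAt.differentiableAt (by simp)).hasFDerivAt
  let τ := hgAt.toOpenPartialHomeomorph g hA' (by simp)
  have hy₀τ : y₀ ∈ τ.source := hgAt.mem_toOpenPartialHomeomorph_source hA' (by simp)
  -- `C^∞` at one point does not spread to a neighbourhood, so `dg` is kept invertible by hand.
  let Q : Set F := O ∩ fderiv ℝ g ⁻¹' Set.range ((↑) : (F ≃L[ℝ] F) → F →L[ℝ] F)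
  have hQ : IsOpen Q := (hg.continuousOn_fderiv_of_isOpen hO (by simp)).isOpen_inter_preimage hO
    ContinuousLinearEquiv.isOpen
  have hsymm : ContDiffOn ℝ ∞ τ.symm (τ.target ∩ τ.symm ⁻¹' Q) := by
    rintro z ⟨hz, hzO, B, hB⟩
    have hgz : ContDiffAt ℝ ∞ g (τ.symm z) := hg.contDiffAt (hO.mem_nhds hzO)
    refine (τ.contDiffAt_symm hz (f₀' := B) ?_ hgz).contDiffWithinAt
    exact hB ▸ (hgz.differentiableAt (by simp)).hasFDerivAt
  have hgQ : g y₀ ∈ τ.target ∩ τ.symm ⁻¹' Q := by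
    refine ⟨τ.map_source hy₀τ, ?_⟩
    rw [Set.mem_preimage, show τ.symm (g y₀) = y₀ from τ.left_inv hy₀τ]
    exact ⟨hy₀, A, hA.symm⟩
  obtain ⟨h, hh, hhτ, -⟩ :=
    exists_contDiff_eventuallyEq (τ.symm.isOpen_inter_preimage hQ) hgQ hsymm
  refine ⟨h, hh, ?_⟩
  filter_upwards [hgAt.continuousAt.eventually hhτ, τ.open_source.mem_nhds hy₀τ] with y hy hyτ
  exact hy.trans (τ.left_inv hyτ)

lemma exists_contDiff_eventually_leftInverse [FiniteDimensional ℝ E] {s : F → E} (hO : IsOpen O)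
    (hy₀ : y₀ ∈ O) (hs : ContDiffOn ℝ ∞ s O) (hinj : Function.Injective (fderiv ℝ s y₀)) :
    ∃ π : E → F, ContDiff ℝ ∞ π ∧ ∀ᶠ y in 𝓝 y₀, π (s y) = y := by
  obtain ⟨L, hL⟩ := (fderiv ℝ s y₀ : F →ₗ[ℝ] E).exists_leftInverse_of_injective
    (LinearMap.ker_eq_bot.2 hinj)
  let L' : E →L[ℝ] F := LinearMap.toContinuousLinearMap L
  have hLs : fderiv ℝ (L' ∘ s) y₀ = (ContinuousLinearEquiv.refl ℝ F : F →L[ℝ] F) := by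
    have hsd : DifferentiableAt ℝ s y₀ :=
      (hs.contDiffAt (hO.mem_nhds hy₀)).differentiableAt (by simp)
    rw [(L'.hasFDerivAt.comp y₀ hsd.hasFDerivAt).fderiv]
    ext y
    exact LinearMap.congr_fun hL y
  obtain ⟨h, hh, hhs⟩ := exists_contDiff_eventually_leftInverse_of_fderiv_eq hO hy₀
    (L'.contDiff.comp_contDiffOn hs) (ContinuousLinearEquiv.refl ℝ F) hLs
  exact ⟨h ∘ L', hh.comp L'.contDiff, hhs⟩

end InverseFunction

section Chart

variable {n : ℕ} {X : Set (EuclideanSpace ℂ (Fin n))}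
  {e : OpenPartialHomeomorph X (EuclideanSpace ℝ (Fin (2 * n - 1)))}

lemma finrank_real_euclideanSpace_complex :
    Module.finrank ℝ (EuclideanSpace ℂ (Fin n)) = 2 * n := by
  rw [finrank_real_of_complex, finrank_euclideanSpace_fin]

/-- The inverse of a chart of `X`, as a map into the ambient space. -/
noncomputable def parametrization
    (e : OpenPartialHomeomorph X (EuclideanSpace ℝ (Fin (2 * n - 1)))) :
    EuclideanSpace ℝ (Fin (2 * n - 1)) → EuclideanSpace ℂ (Fin n) :=
  fun y => e.symm y

lemma parametrization_apply_chart {x : X} (hx : x ∈ e.source) : parametrization e (e x) = x := by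
  rw [parametrization, e.left_inv hx]

namespace IsSmoothChart

variable (he : IsSmoothChart X e)
include he

lemma contDiffOn_parametrization : ContDiffOn ℝ ∞ (parametrization e) e.target :=
  he.contDiffOn

lemma injective_fderiv_parametrization {y : EuclideanSpace ℝ (Fin (2 * n - 1))}
    (hy : y ∈ e.target) : Function.Injective (fderiv ℝ (parametrization e) y) :=
  he.injective y hy

lemma hasFDerivAt_parametrization {y : EuclideanSpace ℝ (Fin (2 * n - 1))} (hy : y ∈ e.target) :
    HasFDerivAt (parametrization e) (fderiv ℝ (parametrization e) y) y :=
  ((he.contDiffOn_parametrization.contDiffAt (e.open_target.mem_nhds hy)).differentiableAt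
    (by simp)).hasFDerivAt

lemma finrank_range_fderiv_parametrization {y : EuclideanSpace ℝ (Fin (2 * n - 1))}
    (hy : y ∈ e.target) :
    Module.finrank ℝ (fderiv ℝ (parametrization e) y).range = 2 * n - 1 := by
  rw [LinearMap.finrank_range_of_inj (he.injective_fderiv_parametrization hy),
    finrank_euclideanSpace_fin]

lemma exists_contDiff_extension {p : X} (hp : p ∈ e.source) :
    ∃ π : EuclideanSpace ℂ (Fin n) → EuclideanSpace ℝ (Fin (2 * n - 1)),
      ContDiff ℝ ∞ π ∧ ∀ᶠ x : X in 𝓝 p, π x = e x := by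
  obtain ⟨π, hπ, hπs⟩ := exists_contDiff_eventually_leftInverse e.open_target (e.map_source hp)
    he.contDiffOn_parametrization (he.injective_fderiv_parametrization (e.map_source hp))
  refine ⟨π, hπ, ?_⟩
  filter_upwards [(e.continuousAt hp).eventually hπs, e.open_source.mem_nhds hp] with x hx hxe
  rwa [parametrization_apply_chart hxe] at hx

lemma tangentVectors_eq_range {x : X} (hx : x ∈ e.source) :
    tangentVectors X x = Set.range (fderiv ℝ (parametrization e) (e x)) := by
  have hs := he.hasFDerivAt_parametrization (e.map_source hx)
  ext v
  constructor
  · rintro ⟨γ, hγ0, hγX, hγ, rfl⟩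
    obtain ⟨π, hπ, hπe⟩ := he.exists_contDiff_extension hx
    have hretract : ∀ᶠ z in 𝓝[X] (x : EuclideanSpace ℂ (Fin n)), parametrization e (π z) = z := by
      rw [← eventually_nhds_subtype_iff]
      filter_upwards [hπe, e.open_source.mem_nhds hx] with z hz hze
      rw [hz, parametrization_apply_chart hze]
    have hγt : Filter.Tendsto γ (𝓝 0) (𝓝[X] x) :=
      tendsto_nhdsWithin_iff.2 ⟨hγ0 ▸ hγ.continuousAt, hγX⟩
    have hγd : HasDerivAt γ (deriv γ 0) 0 := (hγ.differentiableAt (by simp)).hasDerivAt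
    have hπγ := (hπ.differentiable (by simp) (γ 0)).hasFDerivAt.comp_hasDerivAt 0 hγd
    have hsπγ : HasDerivAt (parametrization e ∘ π ∘ γ) _ 0 :=
      HasFDerivAt.comp_hasDerivAt 0 (by simpa only [Function.comp_apply, hγ0, hπe.self_of_nhds])
        hπγ
    exact ⟨_, hsπγ.unique (hγd.congr_of_eventuallyEq (hγt.eventually hretract))⟩
  · rintro ⟨u, rfl⟩
    have hline : ContDiff ℝ ∞ fun t : ℝ => e x + t • u := by fun_prop
    have hmem : e x + (0 : ℝ) • u ∈ e.target := by
      simpa only [zero_smul, add_zero] using e.map_source hx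
    refine ⟨parametrization e ∘ fun t : ℝ => e x + t • u, ?_, .of_forall fun t =>
      Subtype.coe_prop _, ?_, (hs.hasLineDerivAt u).deriv⟩
    · simp only [Function.comp_apply, zero_smul, add_zero, parametrization_apply_chart hx]
    · exact (he.contDiffOn_parametrization.contDiffAt (e.open_target.mem_nhds hmem)).comp (0 : ℝ)
        hline.contDiffAt

lemma exists_contDiff_displacement {p : X} (hp : p ∈ e.source) :
    ∃ r : EuclideanSpace ℂ (Fin n) → EuclideanSpace ℂ (Fin n), ContDiff ℝ ∞ r ∧
      (∀ᶠ x : X in 𝓝 p, r x = 0) ∧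
      ∀ v, v - fderiv ℝ r p v ∈ (fderiv ℝ (parametrization e) (e p)).range := by
  obtain ⟨π, hπ, hπe⟩ := he.exists_contDiff_extension hp
  have hU : IsOpen (π ⁻¹' e.target) := e.open_target.preimage hπ.continuous
  have hpU : (p : EuclideanSpace ℂ (Fin n)) ∈ π ⁻¹' e.target := by
    rw [Set.mem_preimage, hπe.self_of_nhds]
    exact e.map_source hp
  obtain ⟨r, hr, hreq, -⟩ := exists_contDiff_eventuallyEq hU hpU <|
    contDiffOn_id.sub (he.contDiffOn_parametrization.comp hπ.contDiffOn fun x hx => hx)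
  refine ⟨r, hr, ?_, fun v => ?_⟩
  · filter_upwards [continuous_subtype_val.continuousAt.eventually hreq, hπe,
      e.open_source.mem_nhds hp] with x hx hπx hxe
    rw [hx, Function.comp_apply, hπx, parametrization_apply_chart hxe, id, sub_self]
  · have hs : HasFDerivAt (parametrization e) (fderiv ℝ (parametrization e) (e p)) (π p) := by
      rw [hπe.self_of_nhds]
      exact he.hasFDerivAt_parametrization (e.map_source hp)
    have hd := (hasFDerivAt_id (𝕜 := ℝ) (p : EuclideanSpace ℂ (Fin n))).fun_sub
      (hs.comp _ (hπ.differentiable (by simp) _).hasFDerivAt)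
    rw [hreq.fderiv_eq, HasFDerivAt.fderiv hd]
    exact ⟨fderiv ℝ π p v, (sub_sub_cancel v _).symm⟩

lemma exists_contDiff_eventually_eq_zero (hn : 0 < n) {p : X} (hp : p ∈ e.source) :
    ∃ ρ : EuclideanSpace ℂ (Fin n) → ℝ,
      ContDiff ℝ ∞ ρ ∧ (∀ᶠ x : X in 𝓝 p, ρ x = 0) ∧ fderiv ℝ ρ p ≠ 0 := by
  obtain ⟨r, hr, hrX, hrp⟩ := he.exists_contDiff_displacement hp
  have hlt : (fderiv ℝ (parametrization e) (e p)).range < ⊤ := by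
    refine Submodule.lt_top_of_finrank_lt_finrank ?_
    rw [he.finrank_range_fderiv_parametrization (e.map_source hp),
      finrank_real_euclideanSpace_complex]
    lia
  obtain ⟨l, hl0, hl⟩ := Submodule.exists_le_ker_of_lt_top _ hlt
  let L : EuclideanSpace ℂ (Fin n) →L[ℝ] ℝ := LinearMap.toContinuousLinearMap l
  refine ⟨L ∘ r, L.contDiff.comp hr, ?_, fun h => hl0 (LinearMap.ext fun v => ?_)⟩
  · filter_upwards [hrX] with x hx
    rw [Function.comp_apply, hx, map_zero]
  · have hLr : L.comp (fderiv ℝ r p) = 0 :=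
      (L.hasFDerivAt.comp _ (hr.differentiable (by simp) _).hasFDerivAt).fderiv.symm.trans h
    have hlv : l (v - fderiv ℝ r p v) = 0 := hl (hrp v)
    rwa [map_sub, show l (fderiv ℝ r p v) = 0 from DFunLike.congr_fun hLr v, sub_zero] at hlv

lemma tangentVectors_eq_ker {x : X} (hx : x ∈ e.source)
    {ρ : EuclideanSpace ℂ (Fin n) → ℝ} (hρX : ∀ᶠ z : X in 𝓝 x, ρ z = 0) (hρ : fderiv ℝ ρ x ≠ 0) :
    tangentVectors X x = {v | fderiv ℝ ρ x v = 0} := by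
  have hy := e.map_source hx
  have hρd : HasFDerivAt ρ (fderiv ℝ ρ x) (parametrization e (e x)) := by
    rw [parametrization_apply_chart hx]
    exact (not_imp_comm.1 fderiv_zero_of_not_differentiableAt hρ).hasFDerivAt
  have hzero : ρ ∘ parametrization e =ᶠ[𝓝 (e x)] fun _ => 0 :=
    (e.tendsto_symm hx).eventually hρX
  have hcomp : (fderiv ℝ ρ x).comp (fderiv ℝ (parametrization e) (e x)) = 0 :=
    (hρd.comp (e x) (he.hasFDerivAt_parametrization hy)).unique
      ((hasFDerivAt_const 0 _).congr_of_eventuallyEq hzero)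
  have hle : (fderiv ℝ (parametrization e) (e x)).range ≤ (fderiv ℝ ρ x).ker := by
    rintro - ⟨u, rfl⟩
    exact DFunLike.congr_fun hcomp u
  have hker : Module.finrank ℝ (fderiv ℝ ρ x).ker + 1 = 2 * n := by
    rw [← finrank_real_euclideanSpace_complex]
    refine Module.Dual.finrank_ker_add_one_of_ne_zero fun h => hρ ?_
    exact ContinuousLinearMap.coe_injective h
  have heq : (fderiv ℝ (parametrization e) (e x)).range = (fderiv ℝ ρ x).ker := by
    refine Submodule.eq_of_le_of_finrank_eq hle ?_
    rw [he.finrank_range_fderiv_parametrization hy, ← hker, Nat.add_sub_cancel]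
  rw [he.tangentVectors_eq_range hx]
  exact congrArg SetLike.coe heq

end IsSmoothChart

end Chart

section Density

variable {n : ℕ} {X : Set (EuclideanSpace ℂ (Fin n))} {μ : Measure X}
  {e : OpenPartialHomeomorph X (EuclideanSpace ℝ (Fin (2 * n - 1)))}
  {w : EuclideanSpace ℝ (Fin (2 * n - 1)) → ℝ}

/-- In the smooth chart `e` of `X`, the measure `μ` has the smooth positive density `w`. -/
structure IsDensityChart (μ : Measure X)
    (e : OpenPartialHomeomorph X (EuclideanSpace ℝ (Fin (2 * n - 1))))
    (w : EuclideanSpace ℝ (Fin (2 * n - 1)) → ℝ) : Prop where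
  isSmoothChart : IsSmoothChart X e
  contDiffOn_density : ContDiffOn ℝ ∞ w e.target
  density_pos : ∀ y ∈ e.target, 0 < w y
  map_restrict_source : (μ.restrict e.source).map e =
    (volume.restrict e.target).withDensity fun y => ENNReal.ofReal (w y)

lemma exists_isDensityChart (μ : Measure X) [h : IsSmoothPositiveMeasure X μ] (x : X) :
    ∃ e w, IsDensityChart μ e w ∧ x ∈ e.source := by
  obtain ⟨e, w, he, hx, hw, hw0, hμ⟩ := h.exists_density x
  exact ⟨e, w, ⟨he, hw, hw0, hμ⟩, hx⟩

lemma aemeasurable_chart (μ : Measure X)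
    (e : OpenPartialHomeomorph X (EuclideanSpace ℝ (Fin (2 * n - 1)))) :
    AEMeasurable e (μ.restrict e.source) :=
  e.continuousOn.aemeasurable e.open_source.measurableSet

namespace IsDensityChart

variable (h : IsDensityChart μ e w)
include h

lemma aemeasurable_density : AEMeasurable w (volume.restrict e.target) :=
  h.contDiffOn_density.continuousOn.aemeasurable e.open_target.measurableSet

lemma integral_eq_setIntegral_target {G : Type*} [NormedAddCommGroup G] [NormedSpace ℝ G]
    [SecondCountableTopology G] {Φ : X → G} (hΦ : Continuous Φ) (h0 : ∀ x ∉ e.source, Φ x = 0) :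
    ∫ x, Φ x ∂μ = ∫ y in e.target, w y • Φ (e.symm y) := by
  have hsm : AEStronglyMeasurable (fun y => Φ (e.symm y)) ((μ.restrict e.source).map e) := by
    rw [h.map_restrict_source]
    exact ((hΦ.comp_continuousOn e.continuousOn_symm).aestronglyMeasurable
      e.open_target.measurableSet).mono_ac (withDensity_absolutelyContinuous _ _)
  calc ∫ x, Φ x ∂μ = ∫ x in e.source, Φ x ∂μ :=
        (setIntegral_eq_integral_of_forall_compl_eq_zero h0).symm
    _ = ∫ x in e.source, Φ (e.symm (e x)) ∂μ :=
        setIntegral_congr_fun e.open_source.measurableSet fun x hx => by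
          simp only [e.left_inv hx]
    _ = ∫ y, Φ (e.symm y) ∂((μ.restrict e.source).map e) :=
        (integral_map (aemeasurable_chart μ e) hsm).symm
    _ = ∫ y in e.target, (w y).toNNReal • Φ (e.symm y) := by
        rw [h.map_restrict_source,
          ← integral_withDensity_eq_integral_smul₀ h.aemeasurable_density.real_toNNReal]
        rfl
    _ = ∫ y in e.target, w y • Φ (e.symm y) :=
        setIntegral_congr_fun e.open_target.measurableSet fun y hy => by
          simp only [NNReal.smul_def, Real.coe_toNNReal _ (h.density_pos y hy).le]

lemma measure_ne_zero_of_isOpen {U : Set X} (hU : IsOpen U) {p : X} (hp : p ∈ e.source ∩ U) :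
    μ U ≠ 0 := by
  intro hμU
  have hV : IsOpen (e.target ∩ e.symm ⁻¹' U) := e.isOpen_inter_preimage_symm hU
  have hpV : e p ∈ e.target ∩ e.symm ⁻¹' U :=
    ⟨e.map_source hp.1, by simpa only [Set.mem_preimage, e.left_inv hp.1] using hp.2⟩
  have hmap : (μ.restrict e.source).map e (e.target ∩ e.symm ⁻¹' U) = 0 := by
    rw [Measure.map_apply_of_aemeasurable (aemeasurable_chart μ e) hV.measurableSet,
      Measure.restrict_apply' e.open_source.measurableSet]
    refine measure_mono_null (fun x hx => ?_) hμU
    simpa only [Set.mem_preimage, e.left_inv hx.2] using hx.1.2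
  rw [h.map_restrict_source,
    withDensity_apply_eq_zero' h.aemeasurable_density.ennreal_ofReal,
    Measure.restrict_apply' e.open_target.measurableSet] at hmap
  refine (hV.measure_pos volume ⟨_, hpV⟩).ne' (measure_mono_null (fun y hy => ?_) hmap)
  exact ⟨⟨(ENNReal.ofReal_pos.2 (h.density_pos y hy.1)).ne', hy⟩, hy.1⟩

end IsDensityChart

lemma isOpenPosMeasure_of_isSmoothPositiveMeasure (μ : Measure X) [IsSmoothPositiveMeasure X μ] :
    μ.IsOpenPosMeasure where
  open_pos U hU := by
    rintro ⟨p, hp⟩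
    obtain ⟨e, w, h, hpe⟩ := exists_isDensityChart μ p
    exact h.measure_ne_zero_of_isOpen hU ⟨hpe, hp⟩

end Density

section IntegrationByPartsOnHypersurface

variable {n : ℕ} {X : Set (EuclideanSpace ℂ (Fin n))} {μ : Measure X}
  {e : OpenPartialHomeomorph X (EuclideanSpace ℝ (Fin (2 * n - 1)))}
  {w : EuclideanSpace ℝ (Fin (2 * n - 1)) → ℝ}

lemma exists_isOpen_of_eventually_nhds_subtype {Y : Type*} [TopologicalSpace Y] {S : Set Y}
    {P : S → Prop} {p : S} (h : ∀ᶠ x in 𝓝 p, P x) :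
    ∃ W : Set Y, IsOpen W ∧ ↑p ∈ W ∧ ∀ x : S, ↑x ∈ W → P x := by
  rw [nhds_subtype_eq_comap, Filter.eventually_comap, eventually_nhds_iff] at h
  obtain ⟨W, hW, hWo, hpW⟩ := h
  exact ⟨W, hWo, hpW, fun x hx => hW x hx x rfl⟩

/-- `π` is a smooth map on the ambient space that agrees with the chart `e` on `X ∩ W`. -/
structure IsChartExtension (e : OpenPartialHomeomorph X (EuclideanSpace ℝ (Fin (2 * n - 1))))
    (π : EuclideanSpace ℂ (Fin n) → EuclideanSpace ℝ (Fin (2 * n - 1)))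
    (W : Set (EuclideanSpace ℂ (Fin n))) : Prop where
  contDiff : ContDiff ℝ ∞ π
  isOpen : IsOpen W
  mem_source : ∀ x : X, ↑x ∈ W → x ∈ e.source
  apply_eq : ∀ x : X, ↑x ∈ W → π x = e x

lemma IsSmoothChart.exists_isChartExtension (he : IsSmoothChart X e) {p : X} (hp : p ∈ e.source) :
    ∃ π W, IsChartExtension e π W ∧ ↑p ∈ W := by
  obtain ⟨π, hπ, hπe⟩ := he.exists_contDiff_extension hp
  obtain ⟨W, hW, hpW, hWe⟩ :=
    exists_isOpen_of_eventually_nhds_subtype (hπe.and (e.open_source.mem_nhds hp))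
  exact ⟨π, W, ⟨hπ, hW, fun x hx => (hWe x hx).2, fun x hx => (hWe x hx).1⟩, hpW⟩

/-- The vector field `w · e_* b` in the coordinates `e`, extended by zero, for a vector field `b`
tangent to `X`; here `π` is an extension of the coordinate map `e` to the ambient space. -/
noncomputable def weightedChartField
    (e : OpenPartialHomeomorph X (EuclideanSpace ℝ (Fin (2 * n - 1))))
    (w : EuclideanSpace ℝ (Fin (2 * n - 1)) → ℝ)
    (π : EuclideanSpace ℂ (Fin n) → EuclideanSpace ℝ (Fin (2 * n - 1)))
    (b : EuclideanSpace ℂ (Fin n) → EuclideanSpace ℂ (Fin n)) :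
    EuclideanSpace ℝ (Fin (2 * n - 1)) → EuclideanSpace ℝ (Fin (2 * n - 1)) :=
  e.target.indicator fun y =>
    w y • fderiv ℝ π (parametrization e y) (b (parametrization e y))

variable {π : EuclideanSpace ℂ (Fin n) → EuclideanSpace ℝ (Fin (2 * n - 1))}
  {b : EuclideanSpace ℂ (Fin n) → EuclideanSpace ℂ (Fin n)} {W : Set (EuclideanSpace ℂ (Fin n))}

lemma isCompact_image_chart_tsupport [CompactSpace X]
    (hb : ∀ x : X, ↑x ∈ tsupport b → x ∈ e.source) :
    IsCompact (e '' {x : X | ↑x ∈ tsupport b}) :=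
  ((isClosed_tsupport b).preimage continuous_subtype_val).isCompact.image_of_continuousOn
    (e.continuousOn.mono hb)

lemma tsupport_weightedChartField_subset [CompactSpace X]
    (hb : ∀ x : X, ↑x ∈ tsupport b → x ∈ e.source) :
    tsupport (weightedChartField e w π b) ⊆ e '' {x : X | ↑x ∈ tsupport b} := by
  refine closure_minimal (fun y hy => ?_) (isCompact_image_chart_tsupport hb).isClosed
  have hyt : y ∈ e.target := Set.mem_of_indicator_ne_zero hy
  refine ⟨e.symm y, ?_, e.right_inv hyt⟩
  refine subset_tsupport b fun hby => hy ?_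
  rw [weightedChartField, Set.indicator_of_mem hyt, parametrization, hby, map_zero, smul_zero]

lemma contDiff_weightedChartField [CompactSpace X] (h : IsDensityChart μ e w)
    (hπ : ContDiff ℝ ∞ π) (hb : ContDiff ℝ ∞ b) (hbe : ∀ x : X, ↑x ∈ tsupport b → x ∈ e.source) :
    ContDiff ℝ ∞ (weightedChartField e w π b) := by
  refine contDiff_of_tsupport fun y hy => ?_
  obtain ⟨x, hx, rfl⟩ := tsupport_weightedChartField_subset hbe hy
  have hnhds := e.open_target.mem_nhds (e.map_source (hbe x hx))
  have hs := h.isSmoothChart.contDiffOn_parametrization.contDiffAt hnhds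
  have hdπ : ContDiff ℝ ∞ (fderiv ℝ π) := hπ.fderiv_right (by simp)
  refine ((h.contDiffOn_density.contDiffAt hnhds).smul ((hdπ.contDiffAt.comp _ hs).clm_apply
    (hb.contDiffAt.comp _ hs))).congr_of_eventuallyEq ?_
  filter_upwards [hnhds] with z hz using Set.indicator_of_mem hz _

namespace IsChartExtension

variable (hπ : IsChartExtension e π W)
include hπ

lemma apply_symm {y : EuclideanSpace ℝ (Fin (2 * n - 1))} (hy : y ∈ e.target)
    (hyW : parametrization e y ∈ W) : π (parametrization e y) = y :=
  (hπ.apply_eq _ hyW).trans (e.right_inv hy)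

lemma fderiv_parametrization_apply_fderiv (he : IsSmoothChart X e)
    {y : EuclideanSpace ℝ (Fin (2 * n - 1))} (hy : y ∈ e.target) (hyW : parametrization e y ∈ W)
    {u : EuclideanSpace ℂ (Fin n)} (hu : u ∈ tangentVectors X (parametrization e y)) :
    fderiv ℝ (parametrization e) y (fderiv ℝ π (parametrization e y) u) = u := by
  have hs := he.hasFDerivAt_parametrization hy
  have hu' : u ∈ Set.range (fderiv ℝ (parametrization e) y) := by
    rwa [parametrization, he.tangentVectors_eq_range (e.map_target hy), e.right_inv hy] at hu
  obtain ⟨c, rfl⟩ := hu'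
  have hid : π ∘ parametrization e =ᶠ[𝓝 y] id := by
    filter_upwards [hs.continuousAt.preimage_mem_nhds (hπ.isOpen.mem_nhds hyW),
      e.open_target.mem_nhds hy] with z hzW hz
    exact hπ.apply_symm hz hzW
  have hcomp := ((hπ.contDiff.differentiable (by simp) _).hasFDerivAt.comp y hs).unique
    ((hasFDerivAt_id y).congr_of_eventuallyEq hid)
  exact congrArg _ (DFunLike.congr_fun hcomp c)

lemma fderiv_comp_parametrization_weightedChartField (he : IsSmoothChart X e)
    (hbW : tsupport b ⊆ W) (hbX : ∀ x ∈ X, b x ∈ tangentVectors X x)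
    {f : EuclideanSpace ℂ (Fin n) → ℂ} (hf : Differentiable ℝ f)
    {y : EuclideanSpace ℝ (Fin (2 * n - 1))} (hy : y ∈ e.target) :
    fderiv ℝ (f ∘ parametrization e) y (weightedChartField e w π b y) =
      w y • fderiv ℝ f (parametrization e y) (b (parametrization e y)) := by
  have hs := he.hasFDerivAt_parametrization hy
  rw [((hf _).hasFDerivAt.comp y hs).fderiv, weightedChartField, Set.indicator_of_mem hy, map_smul,
    ContinuousLinearMap.comp_apply]
  by_cases hb : parametrization e y ∈ tsupport b
  · rw [hπ.fderiv_parametrization_apply_fderiv he hy (hbW hb) (hbX _ (Subtype.coe_prop _))]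
  · simp only [image_eq_zero_of_notMem_tsupport hb, map_zero]

end IsChartExtension

lemma IsDensityChart.integral_fderiv_apply_eq [CompactSpace X] (h : IsDensityChart μ e w)
    (hπ : IsChartExtension e π W) (hb : ContDiff ℝ ∞ b) (hbW : tsupport b ⊆ W)
    (hbX : ∀ x ∈ X, b x ∈ tangentVectors X x) {f : EuclideanSpace ℂ (Fin n) → ℂ}
    (hf : ContDiff ℝ ∞ f) :
    ∫ x : X, fderiv ℝ f x (b x) ∂μ =
      -∫ y in e.target, divergence (weightedChartField e w π b) y • f (parametrization e y) := by
  set v := weightedChartField e w π b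
  have hbe (x : X) (hx : ↑x ∈ tsupport b) : x ∈ e.source := hπ.mem_source x (hbW hx)
  have hvt : tsupport v ⊆ e.target := (tsupport_weightedChartField_subset hbe).trans
    (Set.image_subset_iff.2 fun x hx => e.map_source (hbe x hx))
  have hvc : HasCompactSupport v := (isCompact_image_chart_tsupport hbe).of_isClosed_subset
    (isClosed_tsupport v) (tsupport_weightedChartField_subset hbe)
  have hfs : ContDiffOn ℝ ∞ (f ∘ parametrization e) e.target :=
    hf.comp_contDiffOn h.isSmoothChart.contDiffOn_parametrization
  have hdf : Continuous fun x : X => fderiv ℝ f x (b x) :=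
    ((hf.continuous_fderiv (by simp)).clm_apply hb.continuous).comp continuous_subtype_val
  calc ∫ x : X, fderiv ℝ f x (b x) ∂μ
      = ∫ y in e.target, w y • fderiv ℝ f (parametrization e y) (b (parametrization e y)) :=
        h.integral_eq_setIntegral_target hdf fun x hx => by
          rw [image_eq_zero_of_notMem_tsupport (mt (hbe x) hx), map_zero]
    _ = ∫ y in e.target, fderiv ℝ (f ∘ parametrization e) y (v y) :=
        setIntegral_congr_fun e.open_target.measurableSet fun y hy =>
          (hπ.fderiv_comp_parametrization_weightedChartField h.isSmoothChart hbW hbX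
            (hf.differentiable (by simp)) hy).symm
    _ = ∫ y, fderiv ℝ (f ∘ parametrization e) y (v y) :=
        setIntegral_eq_integral_of_forall_compl_eq_zero fun y hy => by
          rw [image_eq_zero_of_notMem_tsupport fun hyv => hy (hvt hyv), map_zero]
    _ = -∫ y, divergence v y • (f ∘ parametrization e) y :=
        integral_fderiv_apply_eq_neg_integral_divergence_smul volume
          ((contDiff_weightedChartField h hπ.contDiff hb hbe).of_le (by simp)) hvc fun y hy =>
          (hfs.contDiffAt (e.open_target.mem_nhds (hvt hy))).of_le (by simp)
    _ = -∫ y in e.target, divergence v y • f (parametrization e y) := by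
        rw [setIntegral_eq_integral_of_forall_compl_eq_zero fun y hy => ?_]
        · rfl
        · rw [divergence_eq_zero_of_notMem_tsupport fun hyv => hy (hvt hyv), zero_smul]

lemma IsDensityChart.exists_contDiff_eventually_eq_inv (h : IsDensityChart μ e w)
    (hπ : IsChartExtension e π W) {p : X} (hp : ↑p ∈ W) :
    ∃ r : EuclideanSpace ℂ (Fin n) → ℝ, ContDiff ℝ ∞ r ∧ tsupport r ⊆ W ∧
      ∀ᶠ x in 𝓝 (p : EuclideanSpace ℂ (Fin n)), r x = (w (π x))⁻¹ := by
  have hpt : π p ∈ e.target := by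
    rw [hπ.apply_eq p hp]
    exact e.map_source (hπ.mem_source p hp)
  obtain ⟨r, hr, hreq, hrW⟩ := exists_contDiff_eventuallyEq
    (hπ.isOpen.inter (e.open_target.preimage hπ.contDiff.continuous)) ⟨hp, hpt⟩
    ((h.contDiffOn_density.comp hπ.contDiff.contDiffOn fun x hx => hx.2).inv
      fun x hx => (h.density_pos _ hx.2).ne')
  exact ⟨r, hr, hrW.trans Set.inter_subset_left, hreq⟩

lemma IsDensityChart.smul_divergence_weightedChartField [CompactSpace X] (h : IsDensityChart μ e w)
    (hπ : IsChartExtension e π W) (hbW : tsupport b ⊆ W) {r : EuclideanSpace ℂ (Fin n) → ℝ}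
    (hrW : tsupport r ⊆ W) (hr : ∀ x ∈ tsupport b, r x = (w (π x))⁻¹)
    {y : EuclideanSpace ℝ (Fin (2 * n - 1))} (hy : y ∈ e.target) :
    w y * (r (parametrization e y) *
      divergence (weightedChartField e w π b) (π (parametrization e y))) =
      divergence (weightedChartField e w π b) y := by
  by_cases hyv : y ∈ tsupport (weightedChartField e w π b)
  · obtain ⟨x, hx, rfl⟩ :=
      tsupport_weightedChartField_subset (fun x hx => hπ.mem_source x (hbW hx)) hyv
    rw [parametrization_apply_chart (hπ.mem_source x (hbW hx)), hr x hx, hπ.apply_eq x (hbW hx),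
      mul_inv_cancel_left₀ (h.density_pos _ hy).ne']
  · rw [divergence_eq_zero_of_notMem_tsupport hyv]
    by_cases hry : r (parametrization e y) = 0
    · rw [hry, zero_mul, mul_zero]
    · rw [hπ.apply_symm hy (hrW (subset_tsupport r hry)),
        divergence_eq_zero_of_notMem_tsupport hyv, mul_zero, mul_zero]

theorem exists_isOpen_integral_fderiv_apply_eq [CompactSpace X] (μ : Measure X)
    [IsSmoothPositiveMeasure X μ] (p : X) :
    ∃ U : Set (EuclideanSpace ℂ (Fin n)), IsOpen U ∧ ↑p ∈ U ∧
      ∀ b : EuclideanSpace ℂ (Fin n) → EuclideanSpace ℂ (Fin n), ContDiff ℝ ∞ b → tsupport b ⊆ U →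
      (∀ x ∈ X, b x ∈ tangentVectors X x) → ∃ m : EuclideanSpace ℂ (Fin n) → ℝ, ContDiff ℝ ∞ m ∧
      ∀ f : EuclideanSpace ℂ (Fin n) → ℂ, ContDiff ℝ ∞ f →
        ∫ x : X, fderiv ℝ f x (b x) ∂μ = ∫ x : X, m x • f x ∂μ := by
  obtain ⟨e, w, h, hpe⟩ := exists_isDensityChart μ p
  obtain ⟨π, W, hπ, hpW⟩ := h.isSmoothChart.exists_isChartExtension hpe
  obtain ⟨r, hr, hrW, hrp⟩ := h.exists_contDiff_eventually_eq_inv hπ hpW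
  obtain ⟨U, hU, hUo, hpU⟩ := eventually_nhds_iff.1 (hrp.and (hπ.isOpen.mem_nhds hpW))
  refine ⟨U, hUo, hpU, fun b hb hbU hbX => ?_⟩
  have hbW : tsupport b ⊆ W := fun x hx => (hU x (hbU hx)).2
  have hbe (x : X) (hx : ↑x ∈ tsupport b) : x ∈ e.source := hπ.mem_source x (hbW hx)
  set v := weightedChartField e w π b
  have hv : ContDiff ℝ ∞ (divergence v) :=
    contDiff_divergence (contDiff_weightedChartField h hπ.contDiff hb hbe) (by simp)
  have hm : ContDiff ℝ ∞ fun x => -(r x * divergence v (π x)) :=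
    (hr.mul (hv.comp hπ.contDiff)).neg
  refine ⟨_, hm, fun f hf => ?_⟩
  have hmf : Continuous fun x : X => -(r x * divergence v (π x)) • f x :=
    (hm.continuous.smul hf.continuous).comp continuous_subtype_val
  rw [h.integral_fderiv_apply_eq hπ hb hbW hbX hf, h.integral_eq_setIntegral_target hmf,
    ← integral_neg]
  · refine setIntegral_congr_fun e.open_target.measurableSet fun y hy => ?_
    change -(divergence v y • f (parametrization e y)) = w y • (-(r (parametrization e y) *
      divergence v (π (parametrization e y))) • f (parametrization e y))
    rw [neg_smul, smul_neg, smul_smul, h.smul_divergence_weightedChartField hπ hbW hrW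
      (fun x hx => (hU x (hbU hx)).1) hy]
  · intro x hx
    rw [image_eq_zero_of_notMem_tsupport fun hxr => hx (hπ.mem_source x (hrW hxr)), zero_mul,
      neg_zero, zero_smul]

end IntegrationByPartsOnHypersurface

section SectionT01

lemma exists_contDiff_apply_eq_zero {E : Type*} [NormedAddCommGroup E] [NormedSpace ℂ E]
    [FiniteDimensional ℂ E] (hE : 1 < Module.finrank ℂ E) {L : E → E →L[ℂ] ℂ}
    (hL : ContDiff ℝ ∞ L) {p : E} (hp : L p ≠ 0) {U : Set E} (hU : U ∈ 𝓝 p) :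
    ∃ a : E → E, ContDiff ℝ ∞ a ∧ tsupport a ⊆ U ∧ a p ≠ 0 ∧ ∀ x, L x (a x) = 0 := by
  obtain ⟨χ, hχU, -, hχ, -, hχp⟩ := exists_contDiff_tsupport_subset (n := ⊤) hU
  obtain ⟨u, hu⟩ := DFunLike.ne_iff.1 hp
  obtain ⟨w, hw, hw0⟩ := (Submodule.ne_bot_iff _).1 <|
    LinearMap.ker_ne_bot_of_finrank_lt (f := (L p : E →ₗ[ℂ] ℂ)) (by rwa [Module.finrank_self])
  have hw' : L p w = 0 := hw
  have hLv (v : E) : ContDiff ℝ ∞ fun x => L x v :=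
    (ContinuousLinearMap.apply ℂ ℂ v).restrictScalars ℝ |>.contDiff.comp hL
  refine ⟨fun x => χ x • (L x u • w - L x w • u),
    hχ.smul (((hLv u).smul contDiff_const).sub ((hLv w).smul contDiff_const)),
    (tsupport_smul_subset_left χ _).trans hχU, ?_, fun x => ?_⟩
  · simpa only [hχp, one_smul, hw', zero_smul, sub_zero] using smul_ne_zero hu hw0
  · beta_reduce
    rw [← Complex.coe_smul, map_smul, map_sub, map_smul, map_smul, smul_eq_mul (L x u),
      smul_eq_mul (L x w), mul_comm, sub_self, smul_zero]

variable {n : ℕ} {X : Set (EuclideanSpace ℂ (Fin n))}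
  {e : OpenPartialHomeomorph X (EuclideanSpace ℝ (Fin (2 * n - 1)))}

lemma zero_mem_tangentVectors {x : EuclideanSpace ℂ (Fin n)} (hx : x ∈ X) :
    0 ∈ tangentVectors X x :=
  ⟨fun _ => x, rfl, Filter.Eventually.of_forall fun _ => hx, contDiffAt_const, deriv_const 0 x⟩

lemma IsSmoothChart.exists_isSectionT01 (he : IsSmoothChart X e) (hn : 2 ≤ n) {p : X}
    (hp : p ∈ e.source) {U : Set (EuclideanSpace ℂ (Fin n))} (hU : U ∈ 𝓝 ↑p) :
    ∃ Z : ComplexVectorField n,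
      Z.IsSectionT01 X ∧ tsupport Z.re ⊆ U ∧ tsupport Z.im ⊆ U ∧ Z.re p ≠ 0 := by
  obtain ⟨ρ, hρ, hρX, hρp⟩ := he.exists_contDiff_eventually_eq_zero (by lia) hp
  obtain ⟨W, hW, hpW, hWX⟩ := exists_isOpen_of_eventually_nhds_subtype
    (hρX.eventually_nhds.and (e.open_source.mem_nhds hp))
  have hdρ : ContDiff ℝ ∞ (fderiv ℝ ρ) := hρ.fderiv_right (by simp)
  have hV : U ∩ (W ∩ {x | fderiv ℝ ρ x ≠ 0}) ∈ 𝓝 (p : EuclideanSpace ℂ (Fin n)) :=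
    Filter.inter_mem hU (Filter.inter_mem (hW.mem_nhds hpW)
      (hdρ.continuous.continuousAt.eventually_ne hρp))
  -- The `ℂ`-linear functional with real part `dρ`, that is `2∂ρ`.
  let L (x) : EuclideanSpace ℂ (Fin n) →L[ℂ] ℂ := StrongDual.extendRCLike (fderiv ℝ ρ x)
  have hL : ContDiff ℝ ∞ L :=
    (StrongDual.extendRCLikeₗᵢ (𝕜 := ℂ) (F := EuclideanSpace ℂ (Fin n))).contDiff.comp hdρ
  have hre (x v) : (L x v).re = fderiv ℝ ρ x v :=
    StrongDual.re_extendRCLike_apply (𝕜 := ℂ) (fderiv ℝ ρ x) v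
  have hLp : L p ≠ 0 := fun h => hρp <| ContinuousLinearMap.ext fun v => by
    rw [← hre, h]
    rfl
  obtain ⟨a, ha, haV, hap, hLa⟩ :=
    exists_contDiff_apply_eq_zero (by rwa [finrank_euclideanSpace_fin]) hL hLp hV
  have htangent (x) (hx : x ∈ X) (c : ℂ) : c • a x ∈ tangentVectors X x := by
    by_cases hax : x ∈ tsupport a
    · have hxV := haV hax
      obtain ⟨hx0, hxe⟩ := hWX ⟨x, hx⟩ hxV.2.1
      rw [he.tangentVectors_eq_ker hxe hx0 hxV.2.2, Set.mem_ofPred_eq, ← hre, map_smul, hLa,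
        smul_zero, Complex.zero_re]
    · rw [image_eq_zero_of_notMem_tsupport hax, smul_zero]
      exact zero_mem_tangentVectors hx
  refine ⟨⟨a, fun x => Complex.I • a x, ha, ha.const_smul _⟩,
    fun x hx => ⟨?_, htangent x hx _, rfl⟩,
    haV.trans Set.inter_subset_left, (tsupport_smul_subset_right _ a).trans
      (haV.trans Set.inter_subset_left), hap⟩
  simpa only [one_smul] using htangent x hx 1

end SectionT01

section FormalAdjoint

variable {n : ℕ} {X : Set (EuclideanSpace ℂ (Fin n))}

namespace ComplexVectorField

variable (Z : ComplexVectorField n) {φ g : EuclideanSpace ℂ (Fin n) → ℂ}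

lemma contDiff_apply (hφ : ContDiff ℝ ∞ φ) : ContDiff ℝ ∞ (Z.apply φ) :=
  have hdφ : ContDiff ℝ ∞ (fderiv ℝ φ) := hφ.fderiv_right (by simp)
  (hdφ.clm_apply Z.contDiff_re).add (contDiff_const.mul (hdφ.clm_apply Z.contDiff_im))

lemma apply_mul {x : EuclideanSpace ℂ (Fin n)} (hφ : DifferentiableAt ℝ φ x)
    (hg : DifferentiableAt ℝ g x) :
    Z.apply (fun y => φ y * g y) x = φ x * Z.apply g x + g x * Z.apply φ x := by
  simp only [apply, fderiv_fun_mul hφ hg, _root_.add_apply, _root_.smul_apply, smul_eq_mul]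
  ring

lemma norm_apply_le (φ : EuclideanSpace ℂ (Fin n) → ℂ) (x : EuclideanSpace ℂ (Fin n)) :
    ‖Z.apply φ x‖ ≤ ‖fderiv ℝ φ x‖ * (‖Z.re x‖ + ‖Z.im x‖) := by
  refine (norm_add_le _ _).trans ?_
  rw [norm_mul, Complex.norm_I, one_mul, mul_add]
  exact add_le_add (ContinuousLinearMap.le_opNorm _ _) (ContinuousLinearMap.le_opNorm _ _)

lemma apply_eq_zero_of_notMem_tsupport {x : EuclideanSpace ℂ (Fin n)} (hx : x ∉ tsupport φ) :
    Z.apply φ x = 0 := by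
  rw [apply, image_eq_zero_of_notMem_tsupport fun h => hx (tsupport_fderiv_subset ℝ h),
    _root_.zero_apply, _root_.zero_apply, mul_zero, add_zero]

end ComplexVectorField

lemma integrable_comp_coe {Y F : Type*} [TopologicalSpace Y] [MeasurableSpace Y] {S : Set Y}
    [OpensMeasurableSpace S] [CompactSpace S] [NormedAddCommGroup F] (μ : Measure S)
    [IsFiniteMeasureOnCompacts μ] {f : Y → F} (hf : Continuous f)
    [SecondCountableTopologyEither S F] :
    Integrable (fun x : S => f x) μ :=
  (hf.comp continuous_subtype_val).integrable_of_hasCompactSupport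
    (HasCompactSupport.of_compactSpace _)

variable [CompactSpace X] (μ : Measure X)

lemma exists_isOpen_isFormalAdjoint_one [IsSmoothPositiveMeasure X μ] (p : X) :
    ∃ U : Set (EuclideanSpace ℂ (Fin n)), IsOpen U ∧ ↑p ∈ U ∧ ∀ Z : ComplexVectorField n,
      tsupport Z.re ⊆ U → tsupport Z.im ⊆ U → (∀ x ∈ X, Z.re x ∈ tangentVectors X x) →
      (∀ x ∈ X, Z.im x ∈ tangentVectors X x) →
      ∃ m : EuclideanSpace ℂ (Fin n) → ℂ, ContDiff ℝ ∞ m ∧ IsFormalAdjoint μ Z (fun _ => 1) m := by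
  obtain ⟨U, hU, hpU, hparts⟩ := exists_isOpen_integral_fderiv_apply_eq μ p
  refine ⟨U, hU, hpU, fun Z hreU himU hreX himX => ?_⟩
  obtain ⟨m₁, hm₁, h₁⟩ := hparts Z.re Z.contDiff_re hreU hreX
  obtain ⟨m₂, hm₂, h₂⟩ := hparts Z.im Z.contDiff_im himU himX
  refine ⟨fun x => m₁ x + Complex.I * m₂ x, (Complex.ofRealCLM.contDiff.comp hm₁).add
    (contDiff_const.mul (Complex.ofRealCLM.contDiff.comp hm₂)), fun g hg => ?_⟩
  have hdg := hg.continuous_fderiv (by simp)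
  have hg₁ : Continuous fun x => m₁ x • g x := hm₁.continuous.smul hg.continuous
  have hg₂ : Continuous fun x => m₂ x • g x := hm₂.continuous.smul hg.continuous
  calc ∫ x : X, g x * (m₁ x + Complex.I * m₂ x) ∂μ
      = ∫ x : X, m₁ x • g x + Complex.I * m₂ x • g x ∂μ := by
        congr 1 with x
        simp only [Complex.real_smul]
        ring
    _ = ∫ x : X, fderiv ℝ g x (Z.re x) ∂μ + Complex.I * ∫ x : X, fderiv ℝ g x (Z.im x) ∂μ := by
        rw [integral_add (integrable_comp_coe μ hg₁) ((integrable_comp_coe μ hg₂).const_mul _),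
          integral_const_mul, h₁ g hg, h₂ g hg]
    _ = ∫ x : X, 1 * Z.apply g x ∂μ := by
        simp only [one_mul, ComplexVectorField.apply]
        rw [integral_add (integrable_comp_coe μ (hdg.clm_apply Z.contDiff_re.continuous))
          ((integrable_comp_coe μ (hdg.clm_apply Z.contDiff_im.continuous)).const_mul _),
          integral_const_mul]

variable {μ} in
lemma IsFormalAdjoint.mul_sub_apply [IsFiniteMeasureOnCompacts μ] {Z : ComplexVectorField n}
    {m φ : EuclideanSpace ℂ (Fin n) → ℂ} (h : IsFormalAdjoint μ Z (fun _ => 1) m)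
    (hm : Continuous m) (hφ : ContDiff ℝ ∞ φ) :
    IsFormalAdjoint μ Z φ fun x => m x * φ x - Z.apply φ x := by
  intro g hg
  have hmφg : Continuous fun x => φ x * g x * m x := (hφ.continuous.mul hg.continuous).mul hm
  have hgZφ : Continuous fun x => g x * Z.apply φ x :=
    hg.continuous.mul (Z.contDiff_apply hφ).continuous
  have hφZg : Continuous fun x => φ x * Z.apply g x :=
    hφ.continuous.mul (Z.contDiff_apply hg).continuous
  calc ∫ x : X, g x * (m x * φ x - Z.apply φ x) ∂μ
      = ∫ x : X, φ x * g x * m x - g x * Z.apply φ x ∂μ := by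
        congr 1 with x
        ring
    _ = ∫ x : X, 1 * Z.apply (fun y => φ y * g y) x ∂μ - ∫ x : X, g x * Z.apply φ x ∂μ := by
        rw [integral_sub (integrable_comp_coe μ hmφg) (integrable_comp_coe μ hgZφ),
          h _ (hφ.mul hg)]
    _ = ∫ x : X, φ x * Z.apply g x ∂μ := by
        simp only [one_mul, Z.apply_mul (hφ.differentiable (by simp) _)
          (hg.differentiable (by simp) _)]
        rw [integral_add (integrable_comp_coe μ hφZg) (integrable_comp_coe μ hgZφ),
          add_sub_cancel_right]

end FormalAdjoint

section LocalizedAdjoint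

section Rescaling

variable {E F : Type*} [NormedAddCommGroup E] [NormedSpace ℝ E] [NormedAddCommGroup F]
  [NormedSpace ℝ F] {θ : E → F} {δ : ℝ}

lemma fderiv_smul_comp_inv_smul_sub (hθ : Differentiable ℝ θ) (hδ : δ ≠ 0) (p x : E) :
    fderiv ℝ (fun x => δ • θ (δ⁻¹ • (x - p))) x = fderiv ℝ θ (δ⁻¹ • (x - p)) := by
  have hscale : HasFDerivAt (fun x : E => δ⁻¹ • (x - p)) (δ⁻¹ • ContinuousLinearMap.id ℝ E) x :=
    ((hasFDerivAt_id x).sub_const p).const_smul δ⁻¹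
  refine HasFDerivAt.fderiv ((((hθ _).hasFDerivAt.comp x hscale).const_smul δ).congr_fderiv ?_)
  rw [ContinuousLinearMap.comp_smul, ContinuousLinearMap.comp_id, smul_inv_smul₀ hδ]

lemma tsupport_smul_comp_inv_smul_sub_subset (hθ : tsupport θ ⊆ Metric.ball 0 1) (hδ : 0 < δ)
    (p : E) : tsupport (fun x => δ • θ (δ⁻¹ • (x - p))) ⊆ Metric.closedBall p δ := by
  refine closure_minimal (fun x hx => ?_) Metric.isClosed_closedBall
  have hx' := hθ (subset_tsupport θ (right_ne_zero_of_smul hx))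
  rw [mem_ball_zero_iff, norm_smul, norm_inv, Real.norm_of_nonneg hδ.le, inv_mul_lt_iff₀ hδ,
    mul_one] at hx'
  exact mem_closedBall_iff_norm.2 hx'.le

-- The rescalings `δ θ((x - p) / δ)` of a cut-off `θ` of `ℓ` have equal bounds on the derivative.
lemma exists_contDiff_fderiv_eq_of_mem_nhds [FiniteDimensional ℝ E] (p : E) (ℓ : E →L[ℝ] F) :
    ∃ M : ℝ, ∀ U ∈ 𝓝 p, ∃ φ : E → F, ContDiff ℝ ∞ φ ∧ tsupport φ ⊆ U ∧ φ p = 0 ∧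
      fderiv ℝ φ p = ℓ ∧ ∀ x, ‖φ x‖ ≤ M ∧ ‖fderiv ℝ φ x‖ ≤ M := by
  obtain ⟨θ, hθ, hθℓ, hθsupp⟩ := exists_contDiff_eventuallyEq Metric.isOpen_ball
    (Metric.mem_ball_self (x := (0 : E)) one_pos) ℓ.contDiff.contDiffOn
  have hθc : HasCompactSupport θ := Metric.isCompact_of_isClosed_isBounded (isClosed_tsupport θ)
    (Metric.isBounded_ball.subset hθsupp)
  obtain ⟨M₀, hM₀⟩ := hθc.exists_bound_of_continuous hθ.continuous
  obtain ⟨M₁, hM₁⟩ := (hθc.fderiv ℝ).exists_bound_of_continuous (hθ.continuous_fderiv (by simp))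
  refine ⟨max M₀ M₁, fun U hU => ?_⟩
  obtain ⟨r, hr, hrU⟩ := Metric.nhds_basis_closedBall.mem_iff.1 hU
  obtain ⟨δ, hδ, hδr⟩ := exists_between (lt_min hr one_pos)
  have hφ' := fderiv_smul_comp_inv_smul_sub (hθ.differentiable (by simp)) hδ.ne' p
  refine ⟨fun x => δ • θ (δ⁻¹ • (x - p)),
    (hθ.comp ((contDiff_id.sub contDiff_const).const_smul δ⁻¹)).const_smul δ,
    (tsupport_smul_comp_inv_smul_sub_subset hθsupp hδ p).trans
      ((Metric.closedBall_subset_closedBall (hδr.le.trans (min_le_left _ _))).trans hrU),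
    ?_, ?_, fun x => ⟨?_, ?_⟩⟩
  · simp only [sub_self, smul_zero, hθℓ.self_of_nhds, map_zero]
  · rw [hφ', sub_self, smul_zero, hθℓ.fderiv_eq, ℓ.fderiv]
  · rw [norm_smul, Real.norm_of_nonneg hδ.le]
    exact (mul_le_of_le_one_left (norm_nonneg _) (hδr.le.trans (min_le_right _ _))).trans
      ((hM₀ _).trans (le_max_left _ _))
  · exact hφ' x ▸ (hM₁ _).trans (le_max_right _ _)

end Rescaling

lemma exists_apply_add_I_mul_apply_I_smul_eq_one {E : Type*} [NormedAddCommGroup E]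
    [NormedSpace ℂ E] {a : E} (ha : a ≠ 0) :
    ∃ ℓ : E →L[ℝ] ℂ, ℓ a + Complex.I * ℓ (Complex.I • a) = 1 := by
  obtain ⟨f, hf⟩ := SeparatingDual.exists_eq_one (R := ℂ) ha
  refine ⟨(2⁻¹ : ℝ) • (Complex.conjCLE : ℂ →L[ℝ] ℂ).comp (f.restrictScalars ℝ), ?_⟩
  simp only [_root_.smul_apply, ContinuousLinearMap.comp_apply,
    ContinuousLinearMap.coe_restrictScalars', map_smul, hf, smul_eq_mul, mul_one,
    ContinuousLinearEquiv.coe_coe, Complex.conjCLE_apply, map_one, Complex.conj_I,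
    Complex.real_smul, Complex.ofReal_inv, Complex.ofReal_ofNat]
  linear_combination (-1 / 2) * Complex.I_mul_I

variable {n : ℕ} {X : Set (EuclideanSpace ℂ (Fin n))} [CompactSpace X]

theorem exists_isFormalAdjoint_apply_eq_one (hn : 2 ≤ n) (μ : Measure X)
    [IsSmoothPositiveMeasure X μ] (p : X) :
    ∃ M : ℝ, ∀ U ∈ 𝓝 (p : EuclideanSpace ℂ (Fin n)), ∃ (Z : ComplexVectorField n)
      (φ ψ : EuclideanSpace ℂ (Fin n) → ℂ), Z.IsSectionT01 X ∧ ContDiff ℝ ∞ φ ∧ ContDiff ℝ ∞ ψ ∧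
      IsFormalAdjoint μ Z φ ψ ∧ ψ p = 1 ∧ (∀ x ∈ X, ‖ψ x‖ ≤ M) ∧ ∀ x ∉ U, ψ x = 0 := by
  obtain ⟨e, w, h, hpe⟩ := exists_isDensityChart μ p
  obtain ⟨V, hV, hpV, hadj⟩ := exists_isOpen_isFormalAdjoint_one μ p
  obtain ⟨Z, hZ, hreV, himV, hZp⟩ :=
    h.isSmoothChart.exists_isSectionT01 hn hpe (hV.mem_nhds hpV)
  obtain ⟨m, hm, hm1⟩ := hadj Z hreV himV (fun x hx => (hZ x hx).1) fun x hx => (hZ x hx).2.1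
  obtain ⟨ℓ, hℓ⟩ := exists_apply_add_I_mul_apply_I_smul_eq_one hZp
  obtain ⟨M, hM⟩ := exists_contDiff_fderiv_eq_of_mem_nhds (p : EuclideanSpace ℂ (Fin n)) (-ℓ)
  have hK : Continuous fun x => ‖m x‖ + (‖Z.re x‖ + ‖Z.im x‖) :=
    hm.continuous.norm.add (Z.contDiff_re.continuous.norm.add Z.contDiff_im.continuous.norm)
  obtain ⟨K, hK⟩ := (isCompact_iff_compactSpace.2 ‹CompactSpace X›).exists_bound_of_continuousOn
    hK.continuousOn
  refine ⟨M * K, fun U hU => ?_⟩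
  obtain ⟨φ, hφ, hφU, hφp, hdφp, hφM⟩ := hM U hU
  refine ⟨Z, φ, _, hZ, hφ, (hm.mul hφ).sub (Z.contDiff_apply hφ),
    hm1.mul_sub_apply hm.continuous hφ, ?_, fun x hx => ?_, fun x hx => ?_⟩
  · rw [hφp, mul_zero, zero_sub, ComplexVectorField.apply, hdφp, (hZ p p.2).2.2, _root_.neg_apply,
      _root_.neg_apply, mul_neg, ← neg_add, neg_neg, hℓ]
  · have hM0 : 0 ≤ M := (norm_nonneg _).trans (hφM x).1
    calc ‖m x * φ x - Z.apply φ x‖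
        ≤ ‖m x‖ * ‖φ x‖ + ‖fderiv ℝ φ x‖ * (‖Z.re x‖ + ‖Z.im x‖) :=
          (norm_sub_le _ _).trans (add_le_add (norm_mul_le _ _) (Z.norm_apply_le φ x))
      _ ≤ ‖m x‖ * M + M * (‖Z.re x‖ + ‖Z.im x‖) := by
          gcongr
          exacts [(hφM x).1, (hφM x).2]
      _ = M * (‖m x‖ + (‖Z.re x‖ + ‖Z.im x‖)) := by ring
      _ ≤ M * K := mul_le_mul_of_nonneg_left ((Real.le_norm_self _).trans (hK x hx)) hM0
  · have hx' : x ∉ tsupport φ := fun hxφ => hx (hφU hxφ)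
    rw [image_eq_zero_of_notMem_tsupport hx', Z.apply_eq_zero_of_notMem_tsupport hx', mul_zero,
      sub_zero]

end LocalizedAdjoint

section Transpose

lemma norm_le_of_norm_setIntegral_le {Y F : Type*} [TopologicalSpace Y] [MeasurableSpace Y]
    {μ : Measure Y} [IsFiniteMeasure μ] [μ.IsOpenPosMeasure] [NormedAddCommGroup F]
    [NormedSpace ℝ F] [CompleteSpace F] {A : Y → F} (hA : Continuous A) (hAi : Integrable A μ)
    {K : ℝ} (hK : ∀ U, IsOpen U → ‖∫ x in U, A x ∂μ‖ ≤ K * μ.real U) (p : Y) : ‖A p‖ ≤ K := by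
  refine le_of_forall_pos_le_add fun ε hε => ?_
  let U : Set Y := {x | ‖A x - A p‖ < ε}
  have hU : IsOpen U := isOpen_lt (hA.sub continuous_const).norm continuous_const
  have hU0 : 0 < μ.real U :=
    ENNReal.toReal_pos (hU.measure_ne_zero μ ⟨p, by simpa [U] using hε⟩) (measure_ne_top μ U)
  refine le_of_mul_le_mul_right ?_ hU0
  calc ‖A p‖ * μ.real U = ‖∫ _ in U, A p ∂μ‖ := by
        rw [setIntegral_const, norm_smul, Real.norm_of_nonneg hU0.le, mul_comm]
    _ = ‖∫ x in U, A x ∂μ - ∫ x in U, (A x - A p) ∂μ‖ := by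
        rw [integral_sub hAi.integrableOn (integrable_const _), sub_sub_cancel]
    _ ≤ K * μ.real U + ε * μ.real U := (norm_sub_le _ _).trans (add_le_add (hK U hU)
        (norm_setIntegral_le_of_norm_le_const (measure_lt_top μ U) fun x hx => le_of_lt hx))
    _ = (K + ε) * μ.real U := by ring

lemma integral_norm_indicatorConstLp_le {α : Type*} [MeasurableSpace α] {μ : Measure α}
    [IsFiniteMeasure μ] {T : Lp ℂ 2 μ →L[ℂ] Lp ℂ 2 μ} {C : ℝ≥0}
    (hT : ∀ f : Lp ℂ 2 μ, MemLp f 1 μ → eLpNorm (T f) 1 μ ≤ C * eLpNorm f 1 μ)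
    {U : Set α} (hU : MeasurableSet U) :
    ∫ x, ‖T (indicatorConstLp 2 hU (measure_ne_top μ U) 1) x‖ ∂μ ≤ C * μ.real U := by
  set f : Lp ℂ 2 μ := indicatorConstLp 2 hU (measure_ne_top μ U) 1 with hf
  have hf1 : eLpNorm f 1 μ = μ U := by
    rw [hf, eLpNorm_congr_ae indicatorConstLp_coeFn,
      eLpNorm_indicator_const hU one_ne_zero ENNReal.one_ne_top]
    simp
  have hTf := hT f ((Lp.memLp f).mono_exponent (by norm_num))
  rw [integral_norm_eq_lintegral_enorm (Lp.aestronglyMeasurable _),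
    ← eLpNorm_one_eq_lintegral_enorm]
  refine ENNReal.toReal_le_of_le_ofReal (by positivity) (hTf.trans_eq ?_)
  rw [hf1, ENNReal.ofReal_mul C.coe_nonneg, ENNReal.ofReal_coe_nnreal, ofReal_measureReal]

variable {Y : Type*} [TopologicalSpace Y] [CompactSpace Y] [MeasurableSpace Y] [BorelSpace Y]
  {μ : Measure Y} [IsFiniteMeasure μ]

lemma integrable_Lp_mul_continuousMap (f : Lp ℂ 2 μ) (g : C(Y, ℂ)) :
    Integrable (fun x => f x * g x) μ :=
  (Lp.memLp f).integrable_mul (q := 2)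
    (g.continuous.memLp_of_hasCompactSupport (HasCompactSupport.of_compactSpace g))

/-- The graph of the transpose of `T` on continuous functions: the pairs `(g, A)` such that pairing
`T f` with `g` amounts to pairing `f` with `A`. The pairing is bilinear, not sesquilinear. -/
def transposeGraph (T : Lp ℂ 2 μ →L[ℂ] Lp ℂ 2 μ) : Submodule ℂ (C(Y, ℂ) × C(Y, ℂ)) where
  carrier := {a | ∀ f : Lp ℂ 2 μ, ∫ x, T f x * a.1 x ∂μ = ∫ x, f x * a.2 x ∂μ}
  zero_mem' f := by simp
  add_mem' {a b} ha hb f := by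
    simp only [Prod.fst_add, Prod.snd_add, ContinuousMap.add_apply, mul_add]
    rw [integral_add (integrable_Lp_mul_continuousMap _ _) (integrable_Lp_mul_continuousMap _ _),
      integral_add (integrable_Lp_mul_continuousMap _ _) (integrable_Lp_mul_continuousMap _ _),
      ha, hb]
  smul_mem' c a ha f := by
    simp only [Prod.smul_fst, Prod.smul_snd, ContinuousMap.smul_apply, mul_smul_comm]
    rw [integral_smul, integral_smul, ha]

variable {T : Lp ℂ 2 μ →L[ℂ] Lp ℂ 2 μ} {C : ℝ≥0} {p : Y} {M : ℝ}

lemma norm_setIntegral_le_of_mem_transposeGraph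
    (hT : ∀ f : Lp ℂ 2 μ, MemLp f 1 μ → eLpNorm (T f) 1 μ ≤ C * eLpNorm f 1 μ)
    {a : C(Y, ℂ) × C(Y, ℂ)} (ha : a ∈ transposeGraph T) {U : Set Y} (hU : MeasurableSet U) :
    ‖∫ x in U, a.2 x ∂μ‖ ≤ C * ‖a.1‖ * μ.real U := by
  set f : Lp ℂ 2 μ := indicatorConstLp 2 hU (measure_ne_top μ U) 1 with hf
  have hfa : ∫ x in U, a.2 x ∂μ = ∫ x, f x * a.2 x ∂μ := by
    rw [← integral_indicator hU]
    refine integral_congr_ae ?_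
    filter_upwards [indicatorConstLp_coeFn (p := 2) (hs := hU) (hμs := measure_ne_top μ U)
      (c := (1 : ℂ))] with x hx
    by_cases hxU : x ∈ U <;> simp [hf, hx, hxU]
  have hTf : Integrable (T f) μ := (Lp.memLp (T f)).integrable (by norm_num)
  calc ‖∫ x in U, a.2 x ∂μ‖ = ‖∫ x, T f x * a.1 x ∂μ‖ := by rw [hfa, ha f]
    _ ≤ ∫ x, ‖T f x‖ * ‖a.1‖ ∂μ := by
        refine norm_integral_le_of_norm_le (hTf.norm.mul_const _) (ae_of_all _ fun x => ?_)
        rw [norm_mul]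
        exact mul_le_mul_of_nonneg_left (a.1.norm_coe_le_norm x) (norm_nonneg _)
    _ = (∫ x, ‖T f x‖ ∂μ) * ‖a.1‖ := integral_mul_const _ _
    _ ≤ C * μ.real U * ‖a.1‖ := by
        gcongr
        exact integral_norm_indicatorConstLp_le hT hU
    _ = C * ‖a.1‖ * μ.real U := by ring

theorem norm_apply_le_of_mem_transposeGraph [μ.IsOpenPosMeasure]
    (hT : ∀ f : Lp ℂ 2 μ, MemLp f 1 μ → eLpNorm (T f) 1 μ ≤ C * eLpNorm f 1 μ)
    {a : C(Y, ℂ) × C(Y, ℂ)} (ha : a ∈ transposeGraph T) (p : Y) : ‖a.2 p‖ ≤ C * ‖a.1‖ :=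
  norm_le_of_norm_setIntegral_le a.2.continuous
    (a.2.continuous.integrable_of_hasCompactSupport (HasCompactSupport.of_compactSpace _))
    (fun _ hU => norm_setIntegral_le_of_mem_transposeGraph hT ha hU.measurableSet) p

/-- `T` has humps at `p`: the graph of its transpose contains pairs `(g, A)` with `g p = 0`,
`A p = 1` and `g` bounded by `M` and concentrated arbitrarily close to `p`. -/
def HasHumpsAt (T : Lp ℂ 2 μ →L[ℂ] Lp ℂ 2 μ) (p : Y) (M : ℝ) : Prop :=
  ∀ U ∈ 𝓝 p, ∀ ε > 0, ∃ a ∈ transposeGraph T,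
    a.1 p = 0 ∧ a.2 p = 1 ∧ (∀ x, ‖a.1 x‖ ≤ M) ∧ ∀ x ∉ U, ‖a.1 x‖ ≤ ε

-- Each new hump is concentrated where the sum of the previous ones is still small.
lemma HasHumpsAt.exists_mem_transposeGraph (h : HasHumpsAt T p M) (hM : 0 ≤ M) {ε : ℝ}
    (hε : 0 < ε) (J : ℕ) :
    ∃ a ∈ transposeGraph T, a.1 p = 0 ∧ a.2 p = J ∧ ∀ x, ‖a.1 x‖ ≤ M + J * ε := by
  induction J with
  | zero => exact ⟨0, zero_mem _, rfl, by simp, by simp [hM]⟩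
  | succ J ih =>
    obtain ⟨a, ha, ha₁, ha₂, haM⟩ := ih
    obtain ⟨b, hb, hb₁, hb₂, hbM, hbε⟩ := h {x | ‖a.1 x‖ < ε}
      ((isOpen_lt a.1.continuous.norm continuous_const).mem_nhds (by simpa [ha₁])) ε hε
    refine ⟨a + b, add_mem ha hb, by simp [ha₁, hb₁], by simp [ha₂, hb₂], fun x => ?_⟩
    rw [Prod.fst_add, ContinuousMap.add_apply, Nat.cast_succ]
    refine (norm_add_le _ _).trans ?_
    by_cases hx : ‖a.1 x‖ < ε
    · linarith [hbM x, show 0 ≤ J * ε by positivity]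
    · linarith [haM x, hbε x hx]

theorem HasHumpsAt.not_isBoundedOnL1 [μ.IsOpenPosMeasure] (h : HasHumpsAt T p M) :
    ¬ IsBoundedOnL1 T := by
  rintro ⟨C, hT⟩
  have hM : 0 ≤ M := by
    obtain ⟨a, -, -, -, haM, -⟩ := h Set.univ Filter.univ_mem 1 one_pos
    exact (norm_nonneg _).trans (haM p)
  obtain ⟨J, hJ⟩ := exists_nat_gt (C * (M + 1) : ℝ)
  have hJ0 : (0 : ℝ) < J := lt_of_le_of_lt (by positivity) hJ
  obtain ⟨a, ha, -, haJ, haM⟩ := h.exists_mem_transposeGraph hM (inv_pos.2 hJ0) J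
  rw [mul_inv_cancel₀ hJ0.ne'] at haM
  refine hJ.not_ge ?_
  calc (J : ℝ) = ‖a.2 p‖ := by rw [haJ, Complex.norm_natCast]
    _ ≤ C * ‖a.1‖ := norm_apply_le_of_mem_transposeGraph hT ha p
    _ ≤ C * (M + 1) := by
        gcongr
        exact (ContinuousMap.norm_le _ (by positivity)).2 haM

end Transpose

section PeakFunction

variable {E : Type*} [NormedAddCommGroup E] [InnerProductSpace ℂ E]

lemma norm_one_add_div_two_lt_one {z : ℂ} (hz : ‖z‖ ≤ 1) (hz1 : z ≠ 1) : ‖(1 + z) / 2‖ < 1 := by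
  have h := norm_combo_lt_of_ne norm_one.le hz hz1.symm (a := 2⁻¹) (b := 2⁻¹) (by norm_num)
    (by norm_num) (by norm_num)
  rwa [← smul_add, Complex.real_smul, Complex.ofReal_inv, Complex.ofReal_ofNat, mul_comm,
    ← div_eq_mul_inv] at h

lemma eq_of_inner_eq_norm_sq {q y : E} (hy : ‖y‖ ≤ ‖q‖) (h : inner ℂ q y = (‖q‖ : ℂ) ^ 2) :
    y = q := by
  have hsq := norm_sub_sq (𝕜 := ℂ) q y
  rw [h, RCLike.re_to_complex, ← Complex.ofReal_pow, Complex.ofReal_re] at hsq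
  have hle : ‖q - y‖ ^ 2 ≤ 0 := by nlinarith [norm_nonneg y]
  exact (sub_eq_zero.1 (norm_eq_zero.1 (pow_eq_zero_iff two_ne_zero |>.1
    (le_antisymm hle (sq_nonneg _))))).symm

theorem exists_holomorphic_peak [Nontrivial E] {X : Set E} (hX : IsCompact X) (hne : X.Nonempty) :
    ∃ p ∈ X, ∃ h : E → ℂ, ContDiff ℂ ∞ h ∧ h p = 1 ∧ ∀ x ∈ X, x ≠ p → ‖h x‖ < 1 := by
  have : NoncompactSpace E := NormedSpace.noncompactSpace ℂ E
  obtain ⟨c, hc⟩ := (Set.ne_univ_iff_exists_notMem X).1 hX.ne_univ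
  obtain ⟨p, hp, hmax⟩ := hX.exists_isMaxOn hne (f := fun x => ‖x - c‖) (by fun_prop)
  have hpc : (‖p - c‖ : ℂ) ^ 2 ≠ 0 := by
    simpa [sub_eq_zero] using fun h : p = c => hc (h ▸ hp)
  refine ⟨p, hp, fun x => (1 + inner ℂ (p - c) (x - c) / (‖p - c‖ : ℂ) ^ 2) / 2, ?_, ?_,
    fun x hx hxp => norm_one_add_div_two_lt_one ?_ fun h => hxp ?_⟩
  · have hinner : ContDiff ℂ ∞ fun x => inner ℂ (p - c) (x - c) :=
      (innerSL ℂ (p - c)).contDiff.comp (contDiff_id.sub contDiff_const)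
    exact (contDiff_const.add (hinner.div_const _)).div_const _
  · simp only [inner_self_eq_norm_sq_to_K, Complex.coe_algebraMap, div_self hpc, add_self_div_two]
  · rw [norm_div, norm_pow, Complex.norm_real, norm_norm]
    refine div_le_one_of_le₀ ((norm_inner_le_norm _ _).trans ?_) (by positivity)
    rw [sq]
    exact mul_le_mul_of_nonneg_left (hmax hx) (norm_nonneg _)
  · exact sub_left_injective (eq_of_inner_eq_norm_sq (hmax hx) ((div_eq_one_iff_eq hpc).1 h))

lemma exists_pow_le_of_notMem_nhds {Y : Type*} [TopologicalSpace Y] [CompactSpace Y] {f : Y → ℝ}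
    (hf : Continuous f) (hf0 : ∀ x, 0 ≤ f x) {p : Y} (hlt : ∀ x ≠ p, f x < 1) {U : Set Y}
    (hU : U ∈ 𝓝 p) {ε : ℝ} (hε : 0 < ε) : ∃ N : ℕ, ∀ x ∉ U, f x ^ N ≤ ε := by
  obtain ⟨V, hVU, hV, hpV⟩ := mem_nhds_iff.1 hU
  rcases (Vᶜ).eq_empty_or_nonempty with hempty | hne
  · exact ⟨0, fun x hx => absurd (Set.compl_empty_iff.1 hempty ▸ Set.mem_univ x) (mt (@hVU x) hx)⟩
  · obtain ⟨x₀, hx₀, hmax⟩ := hV.isClosed_compl.isCompact.exists_isMaxOn hne hf.continuousOn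
    obtain ⟨N, hN⟩ := exists_pow_lt_of_lt_one hε (hlt x₀ fun h => hx₀ (h ▸ hpV))
    exact ⟨N, fun x hx => (pow_le_pow_left₀ (hf0 x) (hmax (mt (@hVU x) hx)) N).trans hN.le⟩

end PeakFunction

section SzegoTranspose

variable {n : ℕ} {X : Set (EuclideanSpace ℂ (Fin n))}

lemma ComplexVectorField.IsSectionT01.apply_eq_zero {Z : ComplexVectorField n}
    (hZ : Z.IsSectionT01 X) {H : EuclideanSpace ℂ (Fin n) → ℂ} {x : EuclideanSpace ℂ (Fin n)}
    (hx : x ∈ X) (hH : DifferentiableAt ℂ H x) : Z.apply H x = 0 := by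
  rw [apply, (hZ x hx).2.2, hH.fderiv_restrictScalars ℝ,
    ContinuousLinearMap.coe_restrictScalars', map_smul, smul_eq_mul, ← mul_assoc, Complex.I_mul_I,
    neg_one_mul, add_neg_cancel]

lemma isCR_of_contDiff {μ : Measure X} {H : EuclideanSpace ℂ (Fin n) → ℂ} (hH : ContDiff ℂ ∞ H) :
    IsCR μ fun x : X => H x := by
  intro Z hZ φ ψ _ _ hψ
  rw [hψ H (hH.restrict_scalars ℝ)]
  simp only [hZ.apply_eq_zero (Subtype.prop _) (hH.differentiable (by simp) _), mul_zero,
    integral_zero]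

variable [CompactSpace X] {μ : Measure X} [IsFiniteMeasure μ]

lemma mk_star_star_mem_transposeGraph {h : C(X, ℂ)} (hCR : IsCR μ h) :
    (star h, star h) ∈ transposeGraph (szegoProjection μ) := by
  intro f
  have hmem : MemLp h 2 μ :=
    h.continuous.memLp_of_hasCompactSupport (HasCompactSupport.of_compactSpace _)
  have hinner (g : Lp ℂ 2 μ) : ∫ x, g x * star h x ∂μ = inner ℂ hmem.toLp g := by
    rw [L2.inner_def]
    refine integral_congr_ae ?_
    filter_upwards [hmem.coeFn_toLp] with x hx
    rw [hx, RCLike.inner_apply, ContinuousMap.star_apply, starRingEnd_apply]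
  have hCR2 : hmem.toLp ∈ CR2 μ := by
    intro Z hZ φ ψ hφ hψ hadj
    rw [← hCR Z hZ φ ψ hφ hψ hadj]
    refine integral_congr_ae ?_
    filter_upwards [hmem.coeFn_toLp] with x hx
    rw [hx]
  rw [hinner, hinner, szegoProjection, ← Submodule.inner_starProjection_left_eq_right,
    Submodule.starProjection_eq_self_iff.2 hCR2]

lemma mk_zero_mem_transposeGraph {Z : ComplexVectorField n} (hZ : Z.IsSectionT01 X)
    {φ ψ : EuclideanSpace ℂ (Fin n) → ℂ} (hφ : IsTestFunction X φ) (hψ : IsTestFunction X ψ)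
    (h : IsFormalAdjoint μ Z φ ψ) :
    (⟨fun x => ψ x, hψ.1.continuous.comp continuous_subtype_val⟩, 0) ∈
      transposeGraph (szegoProjection μ) := by
  intro f
  simp only [ContinuousMap.zero_apply, mul_zero, integral_zero]
  exact (Submodule.starProjection_apply_mem (CR2 μ) f : IsCR μ _) Z hZ φ ψ hφ hψ h

lemma IsTestFunction.of_contDiff {φ : EuclideanSpace ℂ (Fin n) → ℂ} (hφ : ContDiff ℝ ∞ φ) :
    IsTestFunction X φ :=
  ⟨hφ, HasCompactSupport.of_compactSpace _⟩

end SzegoTranspose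

theorem exists_hasHumpsAt_szegoProjection {n : ℕ} {X : Set (EuclideanSpace ℂ (Fin n))}
    [CompactSpace X] (hn : 2 ≤ n) (μ : Measure X) [IsSmoothPositiveMeasure X μ]
    {h : EuclideanSpace ℂ (Fin n) → ℂ} {p : X} (hh : ContDiff ℂ ∞ h) (hhp : h p = 1)
    (hlt : ∀ x ∈ X, x ≠ p → ‖h x‖ < 1) : ∃ M : ℝ, HasHumpsAt (szegoProjection μ) p M := by
  have hcont : Continuous fun x : X => h x := hh.continuous.comp continuous_subtype_val
  have hlt' (x : X) (hx : x ≠ p) : ‖h x‖ < 1 := hlt x x.2 (Subtype.coe_ne_coe.2 hx)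
  have hle (x : X) : ‖h x‖ ≤ 1 := by
    rcases eq_or_ne x p with rfl | hx
    exacts [hhp ▸ norm_one.le, (hlt' x hx).le]
  obtain ⟨M, hM⟩ := exists_isFormalAdjoint_apply_eq_one hn μ p
  refine ⟨1 + M, fun U hU ε hε => ?_⟩
  obtain ⟨N, hN⟩ := exists_pow_le_of_notMem_nhds hcont.norm (fun x => norm_nonneg _) hlt' hU hε
  obtain ⟨W, hW, hWU⟩ := mem_nhds_subtype X p U |>.1 hU
  obtain ⟨Z, φ, ψ, hZ, hφ, hψ, hadj, hψp, hψM, hψW⟩ := hM W hW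
  let A : C(X, ℂ) := star ⟨fun x => h x ^ N, hcont.pow N⟩
  have hA (x : X) : ‖A x‖ = ‖h x‖ ^ N := (norm_star _).trans (norm_pow _ _)
  have hAp : A p = 1 := by simp [A, hhp]
  let B : C(X, ℂ) := ⟨fun x => ψ x, hψ.continuous.comp continuous_subtype_val⟩
  have hmem : (A, A) - (B, 0) ∈ transposeGraph (szegoProjection μ) := sub_mem
    (mk_star_star_mem_transposeGraph (isCR_of_contDiff (hh.pow N)))
    (mk_zero_mem_transposeGraph hZ (.of_contDiff hφ) (.of_contDiff hψ) hadj)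
  refine ⟨_, hmem, ?_, ?_, fun x => ?_, fun x hx => ?_⟩
  · exact (congrArg₂ (· - ·) hAp hψp).trans (sub_self 1)
  · exact (sub_zero _).trans hAp
  · exact (norm_sub_le _ _).trans
      (add_le_add ((hA x).trans_le (pow_le_one₀ (norm_nonneg _) (hle x))) (hψM x x.2))
  · have hBx : B x = 0 := hψW x fun hxW => hx (hWU hxW)
    rw [Prod.fst_sub, ContinuousMap.sub_apply, hBx, sub_zero, hA]
    exact hN x hx

lemma nonempty_frontier_of_isBounded {E : Type*} [NormedAddCommGroup E] [NormedSpace ℝ E]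
    [Nontrivial E] {D : Set E} (hb : Bornology.IsBounded D) (hne : D.Nonempty) :
    (frontier D).Nonempty := by
  refine nonempty_frontier_iff.2 ⟨hne, ?_⟩
  rintro rfl
  exact NormedSpace.unbounded_univ ℝ E hb

end Szego

theorem mainTheorem7_general (n : ℕ) (hn : 2 ≤ n) {X : Set (EuclideanSpace ℂ (Fin n))}
    (hX : IsCompact X) (hne : X.Nonempty) (μ : Measure X) [Szego.IsSmoothPositiveMeasure X μ] :
    ¬ Szego.IsBoundedOnL1 (Szego.szegoProjection μ) := by
  have : Nontrivial (Fin n) := Fin.nontrivial_iff_two_le.2 hn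
  have : CompactSpace X := isCompact_iff_compactSpace.1 hX
  have := Szego.isOpenPosMeasure_of_isSmoothPositiveMeasure μ
  obtain ⟨p, hp, h, hh, hhp, hlt⟩ := Szego.exists_holomorphic_peak hX hne
  obtain ⟨M, hM⟩ := Szego.exists_hasHumpsAt_szegoProjection (p := ⟨p, hp⟩) hn μ hh hhp hlt
  exact hM.not_isBoundedOnL1

theorem mainTheorem7 (n : ℕ) (hn : 2 ≤ n) (D : Set (EuclideanSpace ℂ (Fin n)))
    (hD : Szego.IsSmoothlyBoundedDomain D) (hb : Bornology.IsBounded D)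
    (μ : MeasureTheory.Measure (frontier D)) [Szego.IsSmoothPositiveMeasure (frontier D) μ] :
    ¬ Szego.IsBoundedOnL1 (Szego.szegoProjection μ) :=
  have : Nontrivial (Fin n) := Fin.nontrivial_iff_two_le.2 hn
  mainTheorem7_general n hn
    (hb.isCompact_closure.of_isClosed_subset isClosed_frontier frontier_subset_closure)
    (Szego.nonempty_frontier_of_isBounded hb hD.isConnected.nonempty) μ
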